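/- Let $c>0$, $c_{\mathbf z}\ge 0$ and $\kappa>1$ be real numbers, and let $n,d\to\infty$ along a sequence with $n/d\to\kappa$. Put $\Sigma=\frac{c}{d}I_d$ and $\Sigma_{\mathbf z}=\frac{c_{\mathbf z}}{d}I_d$. For a positive semidefinite $d\times d$ matrix $\Sigma_1$ (the covariance of the training noise), let $X,Z\in\mathbb R^{n\times d}$ have mutually independent rows, those of $X$ distributed as $\mathcal N(0,\Sigma)$ and those of $Z$ as $\mathcal N(0,\Sigma_1)$, and let $$W_{\mathrm{lsq}}\in\arg\min_{W\in\mathbb R^{d\times d}}\|(X+Z)W-X\|_F^2 .$$ The generalization error of a matrix $W\in\mathbb R^{d\times d}$ is $$\mathcal E(W)=\mathbb E_{z\sim\mathcal N(0,\Sigma_{\mathbf z})}\,\mathbb E_{x\sim\mathcal N(0,\Sigma)}\|W^{T}(x+z)-x\|_2^2 .$$ Define $$\mathcal E^\ast=\begin{cases}\dfrac{-(c+c_{\mathbf z})^2+4(\kappa-1)^2c\,c_{\mathbf z}}{4(\kappa-2)(\kappa-1)(c+c_{\mathbf z})} & \text{if }(3-2\kappa)c+c_{\mathbf z}<0\text{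 and }c+(3-2\kappa)c_{\mathbf z}<0,\\[2ex] \min\{c,c_{\mathbf z}\} & \text{otherwise.}\end{cases}$$ Then $\mathcal E^\ast$ is the asymptotically optimal generalization error of $W_{\mathrm{lsq}}$ over the choice of $\Sigma_1$, that is: (i) for every choice of (deterministic) positive semidefinite matrices $\Sigma_1=\Sigma_1^{(d)}$ and every $\varepsilon>0$, the probability that $\mathcal E(W_{\mathrm{lsq}})\le\mathcal E^\ast-\varepsilon$ for some least-squares minimizer $W_{\mathrm{lsq}}$ tends to $0$; (ii) for some choice of (deterministic) positive semidefinite matrices $\Sigma_1=\Sigma_1^{(d)}$, $\mathcal E(W_{\mathrm{lsq}})\to\mathcal E^\ast$ in probability, for all least-squares minimizers: for every $\varepsilon>0$, the probability that $|\mathcal E(W_{\mathrm{lsq}})-\mathcal E^\ast|\ge\varepsilon$ for some least-squares minimizer tends to $0$. Moreover there is a phase transition: $\mathcal E^\ast<\min\{c,c_{\mathbf z}\}$ exactly when $(3-2\kappa)c+c_{\mathbf z}<0$ and $c+(3-2\kappa)c_{\mathbf z}<0$. -/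

import Mathlib

open Filter Topology MeasureTheory ProbabilityTheory

namespace LinearDenoiser

/-- The `n × d` data matrix whose `i`-th row is the sample `x i`. -/
def dataMatrix {n d : ℕ} (x : Fin n → EuclideanSpace ℝ (Fin d)) : Matrix (Fin n) (Fin d) ℝ :=
  Matrix.of fun i j => x i j

/-- The squared Frobenius norm of a real matrix. -/
def frobeniusSq {n d : ℕ} (A : Matrix (Fin n) (Fin d) ℝ) : ℝ :=
  ∑ i, ∑ j, (A i j) ^ 2

/-- The joint law of the `n` training samples and the `n` injected noise vectors: all of them are
independent, the samples are `N(0, S)` and the noise vectors are `N(0, S₁)`. -/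
noncomputable def trainingLaw (n : ℕ) {d : ℕ} (S S₁ : Matrix (Fin d) (Fin d) ℝ) :
    Measure ((Fin n → EuclideanSpace ℝ (Fin d)) × (Fin n → EuclideanSpace ℝ (Fin d))) :=
  (Measure.pi fun _ => multivariateGaussian 0 S).prod
    (Measure.pi fun _ => multivariateGaussian 0 S₁)

/-- `W` is a least-squares denoiser for the samples `ω.1` and injected noise `ω.2`: with data
matrix `X` and noise matrix `Z`, it minimizes `‖(X + Z) W - X‖_F ^ 2` over all `d × d` matrices. -/
def IsLeastSquaresDenoiser {n d : ℕ}
    (ω : (Fin n → EuclideanSpace ℝ (Fin d)) × (Fin n → EuclideanSpace ℝ (Fin d)))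
    (W : Matrix (Fin d) (Fin d) ℝ) : Prop :=
  ∀ W' : Matrix (Fin d) (Fin d) ℝ,
    frobeniusSq ((dataMatrix ω.1 + dataMatrix ω.2) * W - dataMatrix ω.1) ≤
      frobeniusSq ((dataMatrix ω.1 + dataMatrix ω.2) * W' - dataMatrix ω.1)

/-- The generalization error `E_z E_x ‖Wᵀ (x + z) - x‖ ^ 2` of the denoiser `W`, where
`x ∼ N(0, S)` and `z ∼ N(0, Sz)`. -/
noncomputable def genError {d : ℕ} (S Sz W : Matrix (Fin d) (Fin d) ℝ) : ℝ :=
  ∫ z, ∫ x, ‖Matrix.toEuclideanCLM (𝕜 := ℝ) W.transpose (x + z) - x‖ ^ 2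
    ∂(multivariateGaussian 0 S) ∂(multivariateGaussian 0 Sz)

/-- The scalar covariance matrix `(c / d) I_d`. -/
noncomputable def scalarCov (d : ℕ) (c : ℝ) : Matrix (Fin d) (Fin d) ℝ :=
  (c / d) • (1 : Matrix (Fin d) (Fin d) ℝ)

/-- The claimed optimal asymptotic generalization error. -/
noncomputable def optimalError (c cz κ : ℝ) : ℝ :=
  if (3 - 2 * κ) * c + cz < 0 ∧ c + (3 - 2 * κ) * cz < 0 then
    (-(c + cz) ^ 2 + 4 * (κ - 1) ^ 2 * c * cz) / (4 * (κ - 2) * (κ - 1) * (c + cz))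
  else min c cz

end LinearDenoiser

/-!
Write `Y = X + Z` for the noisy data, `M` for a standard Gaussian `n × d` matrix, and diagonalize
the noise covariance as `Σ₁ = U diag(ν) Uᵀ`. Coordinate by coordinate in the basis `U`, a sample and
its noise are independent Gaussians, so a suitable reflection turns the pair into two independent
Gaussians one of which is the noisy coordinate and the other the regression residual
(`map_rotatedSample`, `noisy_dataMatrix_rotatedSample`). The normal equations then show that the
least-squares denoiser is, in the basis `U`, the diagonal matrix of the shrinkage factors
`a j = (c / d) / (c / d + ν j)` plus the matrix with entries `√(a i (1 - a j)) H i j`, where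
`H = (MᵀM)⁻¹ Mᵀ M'` for a second, independent standard Gaussian matrix `M'`
(`SatisfiesNormalEquations.conj_apply`).

The generalization error is a quadratic function of the denoiser (`genError_scalarCov`), and it
concentrates in two steps. Given `M`, the columns of `M'` are independent, so that Chebyshev's
inequality applies to a sum of `d` independent quadratic forms
(`measure_quadratic_form_fluctuation_le`); what remains is the weighted trace
`∑ i, a i (MᵀM)⁻¹ i i`. The reciprocal of `(MᵀM)⁻¹ i i` is the squared distance from the `i`-th
column of `M` to the span of the others (`inv_gram_apply_self`), a chi-squared variable with
`n - d + 1` degrees of freedom, and the known mean of its inverse gives closeness in `L¹` to the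
constant `1 / (n - d + 1)` (`lintegral_abs_inv_norm_sq_sub_stdGaussian_le`). As an `L¹` bound is
additive, the dependence between the diagonal entries does not matter, and the resulting bound is
uniform in `Σ₁` (`measure_genError_deviation_le`).

Hence the error is asymptotically `(c + cz) (q + s (1 - s) / (κ - 1)) - 2 c s + c`, where `s` and
`q` are the mean and the mean square of the shrinkage factors. Since `q ≥ s²`, with equality for
equal factors, scalar noise is optimal, and it remains to minimize a quadratic polynomial in `s`
over `[0, 1]`: in the first regime it is convex with its vertex inside the interval, and otherwise the
minimum is at an end point, with value `c` or `cz`.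
-/

namespace LinearDenoiser

/-! ### Moments of Gaussian linear forms -/

section GaussianMoments

lemma integral_sq_gaussianReal : ∫ x, x ^ 2 ∂(gaussianReal 0 1) = 1 := by
  have h := variance_fun_id_gaussianReal (μ := 0) (v := 1)
  rw [variance_eq_integral (by fun_prop)] at h
  simpa using h

lemma integrable_pow_gaussianReal (k : ℕ) : Integrable (fun x : ℝ => x ^ k) (gaussianReal 0 1) := by
  have h := (memLp_id_gaussianReal (μ := 0) (v := 1) k).integrable_norm_pow'
  refine h.mono (by fun_prop) (ae_of_all _ fun x => ?_)
  simp

/-- A crude bound on the fourth moment of a standard Gaussian (its value is `3`), which suffices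
for all uses of Chebyshev's inequality below. -/
lemma integral_pow_four_gaussianReal_le : ∫ x, x ^ 4 ∂(gaussianReal 0 1) ≤ 80 := by
  have hmgf (t : ℝ) : ∫ x, Real.exp (t * x) ∂(gaussianReal 0 1) = Real.exp (t ^ 2 / 2) := by
    have := congrFun (mgf_fun_id_gaussianReal (μ := 0) (v := 1)) t
    simpa [mgf] using this
  have hpt (x : ℝ) : x ^ 4 ≤ 24 * (Real.exp (1 * x) + Real.exp ((-1) * x)) := by
    have key (y : ℝ) (hy : 0 ≤ y) : y ^ 4 / 24 ≤ Real.exp y := by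
      simpa [Nat.factorial] using Real.pow_div_factorial_le_exp y hy 4
    have h1 := key |x| (abs_nonneg x)
    have h2 : Real.exp |x| ≤ Real.exp (1 * x) + Real.exp ((-1) * x) := by
      rcases abs_cases x with ⟨h, -⟩ | ⟨h, -⟩ <;> rw [h] <;> simp [(Real.exp_pos _).le]
    rw [Even.pow_abs ⟨2, rfl⟩] at h1
    linarith
  calc ∫ x, x ^ 4 ∂(gaussianReal 0 1)
      ≤ ∫ x, 24 * (Real.exp (1 * x) + Real.exp ((-1) * x)) ∂(gaussianReal 0 1) := by
        refine integral_mono (integrable_pow_gaussianReal 4) ?_ hpt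
        exact ((integrable_exp_mul_gaussianReal _).add
          (integrable_exp_mul_gaussianReal _)).const_mul _
    _ = 24 * (Real.exp (1 ^ 2 / 2) + Real.exp ((-1) ^ 2 / 2)) := by
        rw [integral_const_mul, integral_add (integrable_exp_mul_gaussianReal _)
          (integrable_exp_mul_gaussianReal _), hmgf, hmgf]
    _ ≤ 80 := by
        have : Real.exp ((1 : ℝ) / 2) ≤ 1.66 := by
          have h := Real.exp_one_lt_d9
          have h2 : Real.exp (1 / 2) ^ 2 = Real.exp 1 := by
            rw [← Real.exp_nat_mul]; norm_num
          nlinarith [Real.exp_pos (1 / 2)]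
        norm_num at this ⊢
        linarith

variable {E : Type*} [NormedAddCommGroup E] [InnerProductSpace ℝ E] [FiniteDimensional ℝ E]
  [MeasurableSpace E] [BorelSpace E]

lemma map_inner_stdGaussian (v : E) :
    (stdGaussian E).map (fun x => inner ℝ v x) =
      (gaussianReal 0 1).map (fun x => ‖v‖ * x) := by
  have h := IsGaussian.map_eq_gaussianReal (μ := stdGaussian E) (innerSL ℝ v)
  rw [integral_strongDual_stdGaussian, variance_dual_stdGaussian] at h
  rw [gaussianReal_map_const_mul]
  simp only [innerSL_apply_norm] at h
  convert! h using 2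
  · simp
  · ext; simp

lemma integral_comp_inner_stdGaussian (v : E) {f : ℝ → ℝ} (hf : Continuous f) :
    ∫ x, f (inner ℝ v x) ∂(stdGaussian E) = ∫ x, f (‖v‖ * x) ∂(gaussianReal 0 1) := by
  have h1 := integral_map (μ := stdGaussian E) (φ := fun x => inner ℝ v x) (f := f)
    (by fun_prop) (by fun_prop)
  have h2 := integral_map (μ := gaussianReal 0 1) (φ := fun x => ‖v‖ * x) (f := f)
    (by fun_prop) (by fun_prop)
  rw [← h1, map_inner_stdGaussian, h2]

lemma integral_inner_stdGaussian (v : E) : ∫ x, inner ℝ v x ∂(stdGaussian E) = 0 := by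
  rw [integral_comp_inner_stdGaussian v (f := fun t => t) (by fun_prop), integral_const_mul]
  simp

lemma integral_inner_sq_stdGaussian (v : E) :
    ∫ x, (inner ℝ v x) ^ 2 ∂(stdGaussian E) = ‖v‖ ^ 2 := by
  rw [integral_comp_inner_stdGaussian v (f := fun t => t ^ 2) (by fun_prop)]
  simp only [mul_pow]
  rw [integral_const_mul, integral_sq_gaussianReal, mul_one]

lemma integral_inner_pow_four_stdGaussian_le (v : E) :
    ∫ x, (inner ℝ v x) ^ 4 ∂(stdGaussian E) ≤ 80 * ‖v‖ ^ 4 := by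
  rw [integral_comp_inner_stdGaussian v (f := fun t => t ^ 4) (by fun_prop)]
  simp only [mul_pow]
  rw [integral_const_mul, mul_comm]
  gcongr
  exact integral_pow_four_gaussianReal_le

lemma integrable_inner_pow_stdGaussian (v : E) (k : ℕ) :
    Integrable (fun x => (inner ℝ v x) ^ k) (stdGaussian E) := by
  have h1 : Integrable (fun t : ℝ => t ^ k) ((stdGaussian E).map (fun x => inner ℝ v x)) := by
    rw [map_inner_stdGaussian, integrable_map_measure (by fun_prop) (by fun_prop)]
    simp only [Function.comp_def, mul_pow]
    exact (integrable_pow_gaussianReal k).const_mul _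
  rwa [integrable_map_measure (by fun_prop) (by fun_prop)] at h1

lemma memLp_inner_stdGaussian (v : E) :
    MemLp (fun x => inner ℝ v x) 2 (stdGaussian E) :=
  (memLp_two_iff_integrable_sq (by fun_prop)).2 (integrable_inner_pow_stdGaussian v 2)

lemma memLp_inner_sq_stdGaussian (v : E) :
    MemLp (fun x => (inner ℝ v x) ^ 2) 2 (stdGaussian E) := by
  refine (memLp_two_iff_integrable_sq (by fun_prop)).2 ?_
  simpa only [← pow_mul] using integrable_inner_pow_stdGaussian v 4

/-- A proper subspace is a null set of the standard Gaussian measure. -/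
lemma stdGaussian_submodule {V : Submodule ℝ E} (hV : V ≠ ⊤) : stdGaussian E (V : Set E) = 0 := by
  obtain ⟨v, hv, hv0⟩ : ∃ v ∈ Vᗮ, v ≠ 0 :=
    (Submodule.ne_bot_iff _).1 fun h => hV ((Submodule.orthogonal_eq_bot_iff).1 h)
  have h0 : stdGaussian E ((fun x => inner ℝ v x) ⁻¹' {0}) = 0 := by
    rw [← Measure.map_apply (by fun_prop) (measurableSet_singleton _), map_inner_stdGaussian,
      gaussianReal_map_const_mul]
    have := nullSingletonClass_gaussianReal (μ := ‖v‖ * 0)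
      (v := .mk (‖v‖ ^ 2) (sq_nonneg _) * 1) (by simpa [← NNReal.coe_eq_zero] using hv0)
    exact measure_singleton _
  exact measure_mono_null (fun x hx => (Submodule.mem_orthogonal' _ _).1 hv x hx) h0

/-- The standard Gaussian measure projects to the standard Gaussian measure of a subspace. -/
lemma map_orthogonalProjection_stdGaussian (V : Submodule ℝ E) :
    (stdGaussian E).map V.orthogonalProjectionOnto = stdGaussian V := by
  apply Measure.ext_of_charFun
  ext t
  have h := charFun_stdGaussian (t : E)
  rw [charFun_apply] at h
  rw [charFun_stdGaussian, charFun_apply, integral_map (by fun_prop) (by fun_prop)]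
  simp only [Submodule.coe_norm, ← h, Submodule.coe_inner,
    Submodule.coe_orthogonalProjectionOnto_apply,
    Submodule.inner_starProjection_left_eq_right, Submodule.starProjection_eq_self_iff.2 t.2]

end GaussianMoments

/-! ### Inverse moments of chi-squared variables -/

section ChiSquared

open scoped ENNReal

variable {E : Type*} [NormedAddCommGroup E] [InnerProductSpace ℝ E] [FiniteDimensional ℝ E]
  [MeasurableSpace E] [BorelSpace E]

lemma norm_sq_sum_stdOrthonormalBasis {F : Type*} [NormedAddCommGroup F] [InnerProductSpace ℝ F]
    [FiniteDimensional ℝ F] (x : Fin (Module.finrank ℝ F) → ℝ) :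
    ‖∑ i, x i • stdOrthonormalBasis ℝ F i‖ ^ 2 = ∑ i, x i ^ 2 := by
  rw [← real_inner_self_eq_norm_sq, Orthonormal.inner_sum
    (stdOrthonormalBasis ℝ F).orthonormal]
  simp [sq]

lemma integral_exp_neg_sq_gaussianReal {t : ℝ} (ht : 0 ≤ t) :
    ∫ x, Real.exp (-t * x ^ 2) ∂(gaussianReal 0 1) = (1 + 2 * t) ^ (-(1 / 2) : ℝ) := by
  rw [integral_gaussianReal_eq_integral_smul one_ne_zero]
  have h (x : ℝ) : gaussianPDFReal 0 1 x • Real.exp (-t * x ^ 2) =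
      (√(2 * Real.pi))⁻¹ * Real.exp (-(t + 1 / 2) * x ^ 2) := by
    rw [gaussianPDFReal_def, smul_eq_mul]
    simp only [NNReal.coe_one, mul_one, sub_zero, mul_assoc, ← Real.exp_add]
    ring_nf
  simp_rw [h]
  rw [integral_const_mul, integral_gaussian, Real.rpow_neg (by positivity), ← Real.sqrt_eq_rpow,
    ← Real.sqrt_inv, ← Real.sqrt_inv, ← Real.sqrt_mul (by positivity)]
  congr 1
  field_simp
  ring

lemma lintegral_exp_neg_norm_sq_stdGaussian {t : ℝ} (ht : 0 ≤ t) :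
    ∫⁻ x, ENNReal.ofReal (Real.exp (-t * ‖x‖ ^ 2)) ∂(stdGaussian E) =
      ENNReal.ofReal ((1 + 2 * t) ^ (-(Module.finrank ℝ E / 2) : ℝ)) := by
  have hint : Integrable (fun x : E => Real.exp (-t * ‖x‖ ^ 2)) (stdGaussian E) := by
    refine (integrable_const (1 : ℝ)).mono' (by fun_prop) (ae_of_all _ fun x => ?_)
    simp only [Real.norm_eq_abs, Real.abs_exp, Real.exp_le_one_iff]
    nlinarith [mul_nonneg ht (sq_nonneg ‖x‖)]
  rw [← ofReal_integral_eq_lintegral_ofReal hint (ae_of_all _ fun x => (Real.exp_pos _).le)]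
  congr 1
  rw [stdGaussian, integral_map (Measurable.aemeasurable (by fun_prop)) (by fun_prop)]
  simp_rw [norm_sq_sum_stdOrthonormalBasis, Finset.mul_sum, Real.exp_sum]
  rw [integral_fintype_prod_eq_prod (f := fun _ y => Real.exp (-t * y ^ 2))]
  simp_rw [integral_exp_neg_sq_gaussianReal ht]
  rw [Finset.prod_const, ← Real.rpow_mul_natCast (by positivity)]
  congr 1
  simp
  ring

lemma lintegral_Ioi_exp_neg {r : ℝ} (hr : 0 ≤ r) :
    ∫⁻ t in Set.Ioi (0 : ℝ), ENNReal.ofReal (Real.exp (-t * r)) = (ENNReal.ofReal r)⁻¹ := by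
  rcases hr.eq_or_lt with rfl | hr
  · simp
  · have h : ∀ t : ℝ, -t * r = -r * t := fun t => by ring
    simp_rw [h]
    rw [← ofReal_integral_eq_lintegral_ofReal (integrableOn_exp_mul_Ioi (by linarith) 0)
      (ae_of_all _ fun x => (Real.exp_pos _).le), integral_exp_mul_Ioi (by linarith),
      ← ENNReal.ofReal_inv_of_pos hr]
    simp

lemma lintegral_Ioi_one_add_rpow {m : ℝ} (hm : 2 < m) :
    ∫⁻ t in Set.Ioi (0 : ℝ), ENNReal.ofReal ((1 + 2 * t) ^ (-(m / 2))) =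
      ENNReal.ofReal (1 / (m - 2)) := by
  have hderiv : ∀ t ∈ Set.Ici (0 : ℝ), HasDerivAt
      (fun t : ℝ => -(1 / (m - 2)) * (1 + 2 * t) ^ (-(m / 2) + 1))
      ((1 + 2 * t) ^ (-(m / 2))) t := by
    intro t ht
    have ht : (0 : ℝ) ≤ t := ht
    have h1 : HasDerivAt (fun t : ℝ => 1 + 2 * t) 2 t := by
      simpa using ((hasDerivAt_id t).const_mul 2).const_add 1
    have h2 := (h1.rpow_const (p := -(m / 2) + 1) (Or.inl (by positivity))).const_mul
      (-(1 / (m - 2)))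
    convert! h2 using 1
    have : m - 2 ≠ 0 := by linarith
    rw [add_sub_cancel_right]
    field_simp
    ring
  have hlim : Tendsto (fun t : ℝ => -(1 / (m - 2)) * (1 + 2 * t) ^ (-(m / 2) + 1)) atTop (𝓝 0) := by
    have h1 : Tendsto (fun t : ℝ => 1 + 2 * t) atTop atTop :=
      tendsto_atTop_add_const_left _ _ (tendsto_id.const_mul_atTop two_pos)
    have h2 := (tendsto_rpow_neg_atTop (y := m / 2 - 1) (by linarith)).comp h1
    have h3 := h2.const_mul (-(1 / (m - 2)))
    simp only [mul_zero] at h3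
    convert! h3 using 3 with t
    simp
    ring_nf
  have hpos : ∀ t ∈ Set.Ioi (0 : ℝ), 0 ≤ (1 + 2 * t) ^ (-(m / 2)) := fun t ht =>
    Real.rpow_nonneg (by have : (0 : ℝ) < t := ht; positivity) _
  have hint := integrableOn_Ioi_deriv_of_nonneg' hderiv hpos hlim
  rw [← ofReal_integral_eq_lintegral_ofReal hint
    ((ae_restrict_iff' measurableSet_Ioi).2 (ae_of_all _ hpos)),
    integral_Ioi_of_hasDerivAt_of_tendsto' hderiv hint hlim]
  simp

/-- The mean of the inverse of a chi-squared variable with `m` degrees of freedom is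
`1 / (m - 2)`: write `1 / r = ∫ exp (-t r) dt` and exchange the integrals. -/
lemma lintegral_inv_norm_sq_stdGaussian (hm : 2 < Module.finrank ℝ E) :
    ∫⁻ x, (ENNReal.ofReal (‖x‖ ^ 2))⁻¹ ∂(stdGaussian E) =
      ENNReal.ofReal (1 / (Module.finrank ℝ E - 2)) := by
  calc ∫⁻ x, (ENNReal.ofReal (‖x‖ ^ 2))⁻¹ ∂(stdGaussian E)
      = ∫⁻ x, (∫⁻ t in Set.Ioi (0 : ℝ), ENNReal.ofReal (Real.exp (-t * ‖x‖ ^ 2)))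
          ∂(stdGaussian E) := by
        simp_rw [lintegral_Ioi_exp_neg (sq_nonneg _)]
    _ = ∫⁻ t in Set.Ioi (0 : ℝ), ∫⁻ x, ENNReal.ofReal (Real.exp (-t * ‖x‖ ^ 2))
          ∂(stdGaussian E) := by
        rw [lintegral_lintegral_swap]
        exact Measurable.aemeasurable (by fun_prop)
    _ = ∫⁻ t in Set.Ioi (0 : ℝ),
          ENNReal.ofReal ((1 + 2 * t) ^ (-((Module.finrank ℝ E : ℝ) / 2))) :=
        setLIntegral_congr_fun measurableSet_Ioi fun t ht =>
          lintegral_exp_neg_norm_sq_stdGaussian (le_of_lt ht)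
    _ = _ := lintegral_Ioi_one_add_rpow (by exact_mod_cast hm)

lemma variance_sq_gaussianReal_le : Var[fun x => x ^ 2; gaussianReal 0 1] ≤ 80 := by
  refine (variance_le_expectation_sq (by fun_prop)).trans ?_
  simpa [← pow_mul] using integral_pow_four_gaussianReal_le

lemma memLp_sq_gaussianReal : MemLp (fun x : ℝ => x ^ 2) 2 (gaussianReal 0 1) :=
  (memLp_two_iff_integrable_sq (by fun_prop)).2
    (by simpa [← pow_mul] using integrable_pow_gaussianReal 4)

lemma memLp_norm_sq_stdGaussian : MemLp (fun x => ‖x‖ ^ 2) 2 (stdGaussian E) := by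
  rw [stdGaussian, memLp_map_measure_iff (by fun_prop) (Measurable.aemeasurable (by fun_prop))]
  simp only [Function.comp_def, norm_sq_sum_stdOrthonormalBasis]
  exact memLp_finsetSum _ fun i _ =>
    memLp_sq_gaussianReal.comp_measurePreserving (measurePreserving_eval _ i)

lemma integral_norm_sq_stdGaussian :
    ∫ x, ‖x‖ ^ 2 ∂(stdGaussian E) = Module.finrank ℝ E := by
  rw [stdGaussian, integral_map (Measurable.aemeasurable (by fun_prop)) (by fun_prop)]
  simp_rw [norm_sq_sum_stdOrthonormalBasis]
  rw [integral_finsetSum]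
  · simp_rw [integral_comp_eval (μ := fun _ : Fin (Module.finrank ℝ E) => gaussianReal 0 1)
      (f := fun x : ℝ => x ^ 2) (by fun_prop), integral_sq_gaussianReal]
    simp
  · exact fun i _ => (memLp_sq_gaussianReal.comp_measurePreserving
      (measurePreserving_eval _ i)).integrable (by norm_num)

lemma variance_norm_sq_stdGaussian_le :
    Var[fun x => ‖x‖ ^ 2; stdGaussian E] ≤ 80 * Module.finrank ℝ E := by
  rw [stdGaussian, variance_map (by fun_prop) (Measurable.aemeasurable (by fun_prop))]
  have h : (fun x : E => ‖x‖ ^ 2) ∘ (fun x : Fin (Module.finrank ℝ E) → ℝ =>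
      ∑ i, x i • stdOrthonormalBasis ℝ E i) = ∑ i, fun x => (x i) ^ 2 := by
    ext x
    simp [norm_sq_sum_stdOrthonormalBasis]
  rw [h, variance_sum_pi (X := fun _ y => y ^ 2) fun _ => memLp_sq_gaussianReal]
  refine (Finset.sum_le_sum fun i _ => variance_sq_gaussianReal_le).trans ?_
  simp [mul_comm]

/-- A chi-squared variable with `m` degrees of freedom is never zero and its inverse is close to
`1 / m` in mean. The bound rests on `|1 / t - 1| ≤ (1 / t - 2 + t) + |1 - t|` for `t > 0`, where
the first summand is nonnegative and its mean is known exactly. -/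
lemma lintegral_abs_inv_norm_sq_sub_stdGaussian_le {m : ℕ} (hm : Module.finrank ℝ E = m)
    (hm2 : 2 < m) :
    ∫⁻ x, ENNReal.ofReal |m * (‖x‖ ^ 2)⁻¹ - 1| ∂(stdGaussian E) ≤
      ENNReal.ofReal (2 / (m - 2) + √(80 / m)) := by
  have hm0 : (0 : ℝ) < m := by positivity
  have hm2' : (0 : ℝ) < m - 2 := by rw [sub_pos]; exact_mod_cast hm2
  have hinv := lintegral_inv_norm_sq_stdGaussian (E := E) (by omega)
  have hpos : ∀ᵐ x ∂(stdGaussian E), 0 < ‖x‖ ^ 2 := by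
    have := ae_lt_top (by fun_prop) (hinv.trans_lt ENNReal.ofReal_lt_top).ne
    filter_upwards [this] with x hx
    simpa only [ENNReal.inv_lt_top, ENNReal.ofReal_pos] using hx
  have hinvR : Integrable (fun x => (‖x‖ ^ 2)⁻¹) (stdGaussian E) ∧
      ∫ x, (‖x‖ ^ 2)⁻¹ ∂(stdGaussian E) = 1 / (m - 2) := by
    have h1 : ∫⁻ x, ENNReal.ofReal ((‖x‖ ^ 2)⁻¹) ∂(stdGaussian E) =
        ENNReal.ofReal (1 / (m - 2)) := by
      rw [← hm, ← hinv]
      refine lintegral_congr_ae ?_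
      filter_upwards [hpos] with x hx
      rw [ENNReal.ofReal_inv_of_pos hx]
    constructor
    · refine (lintegral_ofReal_ne_top_iff_integrable ?_ ?_).1 (h1.trans_ne ENNReal.ofReal_ne_top)
      · exact Measurable.aestronglyMeasurable (by fun_prop)
      · exact ae_of_all _ fun x => by positivity
    · rw [integral_eq_lintegral_of_nonneg_ae (ae_of_all _ fun x => by positivity)
        (Measurable.aestronglyMeasurable (by fun_prop)), h1, ENNReal.toReal_ofReal (by positivity)]
  have hL2 : MemLp (fun x : E => (m : ℝ)⁻¹ * ‖x‖ ^ 2) 2 (stdGaussian E) :=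
    memLp_norm_sq_stdGaussian.const_mul _
  have hmean : ∫ x, (m : ℝ)⁻¹ * ‖x‖ ^ 2 ∂(stdGaussian E) = 1 := by
    rw [integral_const_mul, integral_norm_sq_stdGaussian, hm, inv_mul_cancel₀ hm0.ne']
  have hvar : Var[fun x => (m : ℝ)⁻¹ * ‖x‖ ^ 2; stdGaussian E] ≤ 80 / m := by
    rw [variance_const_mul]
    calc _ ≤ ((m : ℝ)⁻¹) ^ 2 * (80 * m) := by
          gcongr; simpa [hm] using variance_norm_sq_stdGaussian_le (E := E)
      _ = 80 / m := by field_simp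
  have hL1 : Integrable (fun x : E => (m : ℝ)⁻¹ * ‖x‖ ^ 2) (stdGaussian E) :=
    hL2.integrable (by norm_num)
  have habs : ∫ x, |(m : ℝ)⁻¹ * ‖x‖ ^ 2 - 1| ∂(stdGaussian E) ≤ √(80 / m) := by
    have hM : MemLp (fun x : E => |(m : ℝ)⁻¹ * ‖x‖ ^ 2 - 1|) 2 (stdGaussian E) :=
      (hL2.sub (memLp_const 1)).abs
    have h1 := variance_nonneg (fun x : E => |(m : ℝ)⁻¹ * ‖x‖ ^ 2 - 1|) (stdGaussian E)
    rw [variance_eq_sub hM] at h1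
    rw [variance_eq_integral (by fun_prop), hmean] at hvar
    refine Real.le_sqrt_of_sq_le ?_
    simp only [Pi.pow_apply, sq_abs] at h1
    linarith
  have hamgm {t : ℝ} (ht : 0 < t) : 0 ≤ t⁻¹ - 2 + t := by
    have : t⁻¹ - 2 + t = (t - 1) ^ 2 * t⁻¹ := by field_simp; ring
    rw [this]; positivity
  have hbound : ∫⁻ x, ENNReal.ofReal |m * (‖x‖ ^ 2)⁻¹ - 1| ∂(stdGaussian E) ≤
      ∫⁻ x, ENNReal.ofReal ((m * (‖x‖ ^ 2)⁻¹ - 2 + (m : ℝ)⁻¹ * ‖x‖ ^ 2) +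
        |(m : ℝ)⁻¹ * ‖x‖ ^ 2 - 1|) ∂(stdGaussian E) := by
    refine lintegral_mono_ae ?_
    filter_upwards [hpos] with x hx
    refine ENNReal.ofReal_le_ofReal ?_
    set t := (m : ℝ)⁻¹ * ‖x‖ ^ 2 with ht
    have ht0 : 0 < t := by positivity
    have hinv : m * (‖x‖ ^ 2)⁻¹ = t⁻¹ := by rw [ht, mul_inv, inv_inv]
    have h1 : t⁻¹ - 1 = (t⁻¹ - 2 + t) - (t - 1) := by ring
    have h2 := hamgm ht0
    rw [hinv, h1]
    exact (abs_sub _ _).trans_eq (by rw [abs_of_nonneg h2])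
  refine hbound.trans ?_
  have hi0 : Integrable (fun x : E => m * (‖x‖ ^ 2)⁻¹ - 2) (stdGaussian E) :=
    (hinvR.1.const_mul _).sub (integrable_const _)
  have hi1 : Integrable (fun x : E => m * (‖x‖ ^ 2)⁻¹ - 2 + (m : ℝ)⁻¹ * ‖x‖ ^ 2)
      (stdGaussian E) := hi0.add hL1
  have hi2 : Integrable (fun x : E => |(m : ℝ)⁻¹ * ‖x‖ ^ 2 - 1|) (stdGaussian E) :=
    (hL1.sub (integrable_const _)).abs
  have hi : Integrable (fun x : E => (m * (‖x‖ ^ 2)⁻¹ - 2 + (m : ℝ)⁻¹ * ‖x‖ ^ 2) +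
      |(m : ℝ)⁻¹ * ‖x‖ ^ 2 - 1|) (stdGaussian E) := hi1.add hi2
  rw [← ofReal_integral_eq_lintegral_ofReal hi]
  · refine ENNReal.ofReal_le_ofReal ?_
    rw [integral_add hi1 hi2, integral_add hi0 hL1,
      integral_sub (hinvR.1.const_mul _) (integrable_const _), integral_const_mul, hinvR.2, hmean]
    have : (m : ℝ) * (1 / (m - 2)) = 1 + 2 / (m - 2) := by field_simp; ring
    simp only [integral_const, probReal_univ, smul_eq_mul]
    linarith
  · filter_upwards [hpos] with x hx
    have h2 := hamgm (t := (m : ℝ)⁻¹ * ‖x‖ ^ 2) (by positivity)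
    rw [mul_inv, inv_inv] at h2
    exact add_nonneg h2 (abs_nonneg _)

end ChiSquared

/-! ### The inverse Gram matrix of independent Gaussian vectors -/

section GaussianGram

open scoped ENNReal

variable {E : Type*} [NormedAddCommGroup E] [InnerProductSpace ℝ E] {d : ℕ}

lemma continuous_gram : Continuous fun N : Fin d → E => Matrix.gram ℝ N :=
  continuous_matrix fun i j => by
    simp only [Matrix.gram_apply]
    fun_prop

lemma finrank_orthogonal_span [FiniteDimensional ℝ E] {N : Fin d → E}
    (hN : LinearIndependent ℝ N) {m : ℕ} (hm : m + d = Module.finrank ℝ E) :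
    Module.finrank ℝ (Submodule.span ℝ (Set.range N))ᗮ = m := by
  have h1 := Submodule.finrank_add_finrank_orthogonal (Submodule.span ℝ (Set.range N))
  rw [finrank_span_eq_card hN, Fintype.card_fin] at h1
  omega

/-- The reciprocal of a diagonal entry of the inverse Gram matrix is the squared distance from the
corresponding vector to the span of the others. -/
lemma inv_gram_apply_self [FiniteDimensional ℝ E] {N : Fin (d + 1) → E}
    (hN : LinearIndependent ℝ N) (i : Fin (d + 1)) {g : Fin d → E} (hg : i.removeNth N = g) :
    (Matrix.gram ℝ N)⁻¹ i i =
      (‖(Submodule.span ℝ (Set.range g))ᗮ.orthogonalProjectionOnto (N i)‖ ^ 2)⁻¹ := by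
  subst hg
  set V := Submodule.span ℝ (Set.range (i.removeNth N)) with hV
  set r := Vᗮ.orthogonalProjectionOnto (N i) with hr
  have hdet : IsUnit (Matrix.gram ℝ N).det :=
    isUnit_iff_ne_zero.2 (Matrix.det_gram_ne_zero_iff_linearIndependent.2 hN)
  -- The residual of `N i` is a combination of all the vectors in which `N i` has weight one.
  obtain ⟨w, hwi, hw⟩ : ∃ w : Fin (d + 1) → ℝ, w i = 1 ∧ ∑ j, w j • N j = (r : E) := by
    have hmem : N i - r ∈ V := by
      have := Submodule.sub_starProjection_mem_orthogonal (K := Vᗮ) (N i)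
      rwa [Submodule.orthogonal_orthogonal] at this
    obtain ⟨u, hu⟩ := (Submodule.mem_span_range_iff_exists_fun ℝ).1 hmem
    refine ⟨i.insertNth 1 (fun j => - u j), by simp, ?_⟩
    rw [Fin.sum_univ_succAbove _ i]
    simp only [Fin.insertNth_apply_same, one_smul, Fin.insertNth_apply_succAbove, neg_smul,
      Finset.sum_neg_distrib]
    simp only [Fin.removeNth] at hu
    rw [hu]
    abel
  have hmul : Matrix.mulVec (Matrix.gram ℝ N) w = Pi.single i (‖r‖ ^ 2) := by
    ext j
    have h1 : Matrix.mulVec (Matrix.gram ℝ N) w j = inner ℝ (N j) (r : E) := by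
      rw [← hw, inner_sum]
      simp [Matrix.mulVec, dotProduct, inner_smul_right, mul_comm]
    rw [h1]
    rcases eq_or_ne j i with rfl | hj
    · rw [Pi.single_eq_same, hr, ← Submodule.inner_orthogonalProjectionOnto_eq_of_mem_right,
        real_inner_self_eq_norm_sq]
    · rw [Pi.single_eq_of_ne hj]
      obtain ⟨k, rfl⟩ := Fin.exists_succAbove_eq hj
      exact (Submodule.mem_orthogonal _ _).1 r.2 _ (Submodule.subset_span ⟨k, rfl⟩)
  have h2 : w = Matrix.mulVec (Matrix.gram ℝ N)⁻¹ (Pi.single i (‖r‖ ^ 2)) := by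
    rw [← hmul, Matrix.mulVec_mulVec, Matrix.nonsing_inv_mul _ hdet, Matrix.one_mulVec]
  have h3 := congrFun h2 i
  rw [hwi, Matrix.mulVec_single] at h3
  simp only [Matrix.col_apply, Pi.smul_apply, MulOpposite.smul_eq_mul_unop,
    MulOpposite.unop_op] at h3
  exact eq_inv_of_mul_eq_one_left h3.symm

variable [FiniteDimensional ℝ E] [MeasurableSpace E] [BorelSpace E]

lemma measurable_inv_gram (i j : Fin d) :
    Measurable fun N : Fin d → E => (Matrix.gram ℝ N)⁻¹ i j := by
  simp only [Matrix.inv_def, Matrix.smul_apply, Ring.inverse_eq_inv', smul_eq_mul]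
  exact (continuous_gram.matrix_det.measurable.inv).mul
    ((continuous_gram.matrix_adjugate.matrix_elem i j).measurable)

lemma measurePreserving_removeNth (i : Fin (d + 1)) :
    MeasurePreserving (fun N : Fin (d + 1) → E => (i.removeNth N, N i))
      (Measure.pi fun _ => stdGaussian E)
      ((Measure.pi fun _ => stdGaussian E).prod (stdGaussian E)) :=
  Measure.measurePreserving_swap.comp
    (measurePreserving_piFinSuccAbove (fun _ : Fin (d + 1) => stdGaussian E) i)

lemma measurable_insertNth {F : Type*} [MeasurableSpace F] (i : Fin (d + 1)) :
    Measurable fun p : (Fin d → F) × F => (i.insertNth p.2 p.1 : Fin (d + 1) → F) :=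
  measurable_pi_iff.2 <| i.forall_iff_succAbove.2
    ⟨by simpa using measurable_snd, fun j => by
      simp only [Fin.insertNth_apply_succAbove]
      fun_prop⟩

lemma measurableSet_linearIndependent :
    MeasurableSet {N : Fin d → E | LinearIndependent ℝ N} := by
  simp_rw [← Matrix.det_gram_ne_zero_iff_linearIndependent]
  exact (isOpen_ne_fun continuous_gram.matrix_det continuous_const).measurableSet

/-- At most `dim E` independent standard Gaussian vectors are almost surely linearly
independent. -/
lemma ae_linearIndependent (hd : d ≤ Module.finrank ℝ E) :
    ∀ᵐ N ∂(Measure.pi fun _ : Fin d => stdGaussian E), LinearIndependent ℝ N := by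
  induction d with
  | zero => exact ae_of_all _ fun N => linearIndependent_empty_type
  | succ d ih =>
    have hms : MeasurableSet {p : (Fin d → E) × E |
        LinearIndependent ℝ ((0 : Fin (d + 1)).insertNth p.2 p.1 : Fin (d + 1) → E)} :=
      measurable_insertNth 0 measurableSet_linearIndependent
    have key : ∀ᵐ p ∂((Measure.pi fun _ : Fin d => stdGaussian E).prod (stdGaussian E)),
        LinearIndependent ℝ ((0 : Fin (d + 1)).insertNth p.2 p.1 : Fin (d + 1) → E) := by
      refine (Measure.ae_prod_iff_ae_ae hms).2 ?_
      filter_upwards [ih (by omega)] with g hg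
      have hV : Submodule.span ℝ (Set.range g) ≠ ⊤ := fun h => by
        have := finrank_span_eq_card hg
        rw [h, finrank_top, Fintype.card_fin] at this
        omega
      have hnull : ∀ᵐ y ∂(stdGaussian E), y ∉ Submodule.span ℝ (Set.range g) :=
        measure_eq_zero_iff_ae_notMem.1 (stdGaussian_submodule hV)
      filter_upwards [hnull] with y hy
      rw [Fin.insertNth_zero]
      exact linearIndependent_finCons.2 ⟨hg, hy⟩
    filter_upwards [(measurePreserving_removeNth (0 : Fin (d + 1))).quasiMeasurePreserving.ae key]
      with N hN
    simpa only [Fin.insertNth_self_removeNth] using hN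

/-- Given the other vectors, a diagonal entry of the inverse Gram matrix is the inverse of a
chi-squared variable. -/
lemma lintegral_abs_mul_inv_gram_sub_one_le {m : ℕ} (hm : m + d = Module.finrank ℝ E + 1)
    (hm2 : 2 < m) (i : Fin d) :
    ∫⁻ N, ENNReal.ofReal |m * (Matrix.gram ℝ N)⁻¹ i i - 1|
        ∂(Measure.pi fun _ : Fin d => stdGaussian E) ≤
      ENNReal.ofReal (2 / (m - 2) + √(80 / m)) := by
  obtain _ | d := d
  · exact i.elim0
  have hmp := measurePreserving_removeNth (E := E) i
  set F : (Fin d → E) × E → ℝ≥0∞ := fun p =>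
    ENNReal.ofReal |m * (Matrix.gram ℝ (i.insertNth p.2 p.1 : Fin (d + 1) → E))⁻¹ i i - 1| with hF
  have hFm : Measurable F :=
    ((((measurable_inv_gram i i).comp
      (measurable_insertNth i)).const_mul _).sub_const _).abs.ennreal_ofReal
  have hli : ∀ᵐ p ∂((Measure.pi fun _ : Fin d => stdGaussian E).prod (stdGaussian E)),
      LinearIndependent ℝ (i.insertNth p.2 p.1 : Fin (d + 1) → E) := by
    have hms : MeasurableSet {p : (Fin d → E) × E |
        LinearIndependent ℝ (i.insertNth p.2 p.1 : Fin (d + 1) → E)} :=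
      measurable_insertNth i measurableSet_linearIndependent
    rw [← hmp.map_eq, ae_map_iff hmp.measurable.aemeasurable hms]
    filter_upwards [ae_linearIndependent (E := E) (d := d + 1) (by omega)] with N hN
    simpa only [Fin.insertNth_self_removeNth] using hN
  calc ∫⁻ N, ENNReal.ofReal |m * (Matrix.gram ℝ N)⁻¹ i i - 1|
        ∂(Measure.pi fun _ : Fin (d + 1) => stdGaussian E)
      = ∫⁻ N, F (i.removeNth N, N i) ∂(Measure.pi fun _ : Fin (d + 1) => stdGaussian E) := by
        simp only [hF, Fin.insertNth_self_removeNth]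
    _ = ∫⁻ g, ∫⁻ y, F (g, y) ∂(stdGaussian E) ∂(Measure.pi fun _ : Fin d => stdGaussian E) := by
        rw [hmp.lintegral_comp hFm, lintegral_prod _ hFm.aemeasurable]
    _ ≤ ∫⁻ g, ENNReal.ofReal (2 / (m - 2) + √(80 / m))
          ∂(Measure.pi fun _ : Fin d => stdGaussian E) := by
        refine lintegral_mono_ae ?_
        filter_upwards [Measure.ae_ae_of_ae_prod hli, ae_linearIndependent (E := E) (d := d)
          (by omega)] with g hg hg0
        set V := (Submodule.span ℝ (Set.range g))ᗮ
        have hV : Module.finrank ℝ V = m :=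
          finrank_orthogonal_span hg0 (by omega)
        refine le_trans (le_of_eq ?_) (lintegral_abs_inv_norm_sq_sub_stdGaussian_le hV hm2)
        rw [← map_orthogonalProjection_stdGaussian, lintegral_map
          (Measurable.ennreal_ofReal (by fun_prop)) (by fun_prop)]
        refine lintegral_congr_ae ?_
        filter_upwards [hg] with y hy
        simp only [hF, inv_gram_apply_self hy i (g := g) (by simp), Fin.insertNth_apply_same]
        rfl
    _ = _ := by simp

/-- Concentration of weighted traces of the inverse Gram matrix of `d` independent standard
Gaussian vectors. A first moment bound for each diagonal entry suffices, so that their dependence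
is immaterial. -/
lemma measure_weighted_trace_inv_gram_le {m : ℕ} (hm : m + d = Module.finrank ℝ E + 1)
    (hm2 : 2 < m) {a : Fin d → ℝ} (ha : ∀ i, a i ∈ Set.Icc 0 1) {δ : ℝ} (hδ : 0 < δ) :
    (Measure.pi fun _ : Fin d => stdGaussian E)
        {N | δ ≤ |∑ i, a i * (Matrix.gram ℝ N)⁻¹ i i - (∑ i, a i) / m|} ≤
      ENNReal.ofReal (d / m * (2 / (m - 2) + √(80 / m)) / δ) := by
  have hm0 : (0 : ℝ) < m := by positivity
  have hm2' : (0 : ℝ) < m - 2 := by rw [sub_pos]; exact_mod_cast hm2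
  have hpt (N : Fin d → E) :
      ENNReal.ofReal |∑ i, a i * (Matrix.gram ℝ N)⁻¹ i i - (∑ i, a i) / m| ≤
        ∑ i, ENNReal.ofReal (1 / m) * ENNReal.ofReal |m * (Matrix.gram ℝ N)⁻¹ i i - 1| := by
    simp_rw [← ENNReal.ofReal_mul (show (0 : ℝ) ≤ 1 / m by positivity)]
    rw [← ENNReal.ofReal_sum_of_nonneg fun i _ => by positivity]
    refine ENNReal.ofReal_le_ofReal ?_
    rw [Finset.sum_div, ← Finset.sum_sub_distrib]
    refine (Finset.abs_sum_le_sum_abs _ _).trans (Finset.sum_le_sum fun i _ => ?_)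
    have : a i * (Matrix.gram ℝ N)⁻¹ i i - a i / m =
        a i * (1 / m * (m * (Matrix.gram ℝ N)⁻¹ i i - 1)) := by field_simp
    rw [this, abs_mul, abs_mul, abs_of_nonneg (ha i).1,
      abs_of_nonneg (show (0 : ℝ) ≤ 1 / m by positivity)]
    exact mul_le_of_le_one_left (by positivity) (ha i).2
  have hKm (i : Fin d) : Measurable fun N : Fin d → E =>
      ENNReal.ofReal |m * (Matrix.gram ℝ N)⁻¹ i i - 1| :=
    (((measurable_inv_gram i i).const_mul _).sub_const _).abs.ennreal_ofReal
  have hTm : Measurable fun N : Fin d → E =>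
      ENNReal.ofReal |∑ i, a i * (Matrix.gram ℝ N)⁻¹ i i - (∑ i, a i) / m| :=
    ((Finset.measurable_sum _ fun i _ =>
      (measurable_inv_gram i i).const_mul _).sub_const _).abs.ennreal_ofReal
  have hmean : ∫⁻ N, ENNReal.ofReal |∑ i, a i * (Matrix.gram ℝ N)⁻¹ i i - (∑ i, a i) / m|
      ∂(Measure.pi fun _ : Fin d => stdGaussian E) ≤
        ENNReal.ofReal (d / m * (2 / (m - 2) + √(80 / m))) := by
    refine (lintegral_mono hpt).trans ?_
    rw [lintegral_finsetSum _ fun i _ => (hKm i).const_mul _]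
    calc _ ≤ ∑ i : Fin d, ENNReal.ofReal (1 / m) *
          ENNReal.ofReal (2 / (m - 2) + √(80 / m)) := by
          refine Finset.sum_le_sum fun i _ => ?_
          rw [lintegral_const_mul _ (hKm i)]
          exact mul_le_mul' le_rfl (lintegral_abs_mul_inv_gram_sub_one_le hm hm2 i)
      _ = _ := by
          rw [Finset.sum_const, Finset.card_univ, Fintype.card_fin, nsmul_eq_mul,
            ← ENNReal.ofReal_natCast, ← ENNReal.ofReal_mul (by positivity),
            ← ENNReal.ofReal_mul (by positivity)]
          congr 1
          ring
  have hmarkov := meas_ge_le_lintegral_div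
    (μ := Measure.pi fun _ : Fin d => stdGaussian E)
    hTm.aemeasurable (ε := ENNReal.ofReal δ) (by simpa using hδ)
    ENNReal.ofReal_ne_top
  simp only [ENNReal.ofReal_le_ofReal_iff (abs_nonneg _)] at hmarkov
  refine hmarkov.trans ?_
  rw [ENNReal.ofReal_div_of_pos hδ]
  exact ENNReal.div_le_div_right hmean _

end GaussianGram

/-! ### Fluctuations given the noisy data -/

section Fluctuations

open scoped ENNReal

variable {E : Type*} [NormedAddCommGroup E] [InnerProductSpace ℝ E] [FiniteDimensional ℝ E]
  [MeasurableSpace E] [BorelSpace E] {d : ℕ}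

lemma memLp_weighted_sum_inner_sq (a : Fin d → ℝ) (p : Fin d → E) :
    MemLp (fun x => ∑ i, a i * (inner ℝ (p i) x) ^ 2) 2 (stdGaussian E) :=
  memLp_finsetSum _ fun i _ => (memLp_inner_sq_stdGaussian (p i)).const_mul _

lemma integral_weighted_sum_inner_sq (a : Fin d → ℝ) (p : Fin d → E) :
    ∫ x, ∑ i, a i * (inner ℝ (p i) x) ^ 2 ∂(stdGaussian E) = ∑ i, a i * ‖p i‖ ^ 2 := by
  rw [integral_finsetSum _ fun i _ => (integrable_inner_pow_stdGaussian (p i) 2).const_mul _]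
  simp_rw [integral_const_mul, integral_inner_sq_stdGaussian]

lemma integral_weighted_sum_inner_sq_sq_le {a : Fin d → ℝ} (ha : ∀ i, 0 ≤ a i) (p : Fin d → E) :
    ∫ x, (∑ i, a i * (inner ℝ (p i) x) ^ 2) ^ 2 ∂(stdGaussian E) ≤
      80 * (∑ i, a i * ‖p i‖ ^ 2) ^ 2 := by
  have hpt (x : E) : (∑ i, a i * (inner ℝ (p i) x) ^ 2) ^ 2 ≤
      (∑ i, a i * ‖p i‖ ^ 2) * ∑ i, a i / ‖p i‖ ^ 2 * (inner ℝ (p i) x) ^ 4 := by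
    refine Finset.sum_sq_le_sum_mul_sum_of_sq_le_mul _ (fun i _ => ?_) (fun i _ => ?_)
      fun i _ => ?_
    · have := ha i; positivity
    · have := ha i; positivity
    · rcases eq_or_ne (p i) 0 with h | h
      · simp [h]
      · have := norm_ne_zero_iff.2 h
        exact le_of_eq (by field_simp)
  have hint : Integrable (fun x => (∑ i, a i * ‖p i‖ ^ 2) *
      ∑ i, a i / ‖p i‖ ^ 2 * (inner ℝ (p i) x) ^ 4) (stdGaussian E) :=
    (integrable_finsetSum _ fun i _ =>
      (integrable_inner_pow_stdGaussian (p i) 4).const_mul _).const_mul _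
  refine (integral_mono ((memLp_weighted_sum_inner_sq a p).integrable_sq) hint hpt).trans ?_
  rw [integral_const_mul, integral_finsetSum _ fun i _ =>
    (integrable_inner_pow_stdGaussian (p i) 4).const_mul _]
  simp_rw [integral_const_mul]
  have h0 : 0 ≤ ∑ i, a i * ‖p i‖ ^ 2 :=
    Finset.sum_nonneg fun i _ => mul_nonneg (ha i) (sq_nonneg _)
  have hsum : ∑ i, a i / ‖p i‖ ^ 2 * ∫ x, (inner ℝ (p i) x) ^ 4 ∂(stdGaussian E) ≤
      80 * ∑ i, a i * ‖p i‖ ^ 2 := by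
    rw [Finset.mul_sum]
    refine Finset.sum_le_sum fun i _ => ?_
    calc a i / ‖p i‖ ^ 2 * ∫ x, (inner ℝ (p i) x) ^ 4 ∂(stdGaussian E)
        ≤ a i / ‖p i‖ ^ 2 * (80 * ‖p i‖ ^ 4) := by
          gcongr
          · exact div_nonneg (ha i) (sq_nonneg _)
          · exact integral_inner_pow_four_stdGaussian_le _
      _ = 80 * (a i * ‖p i‖ ^ 2) := by
          rcases eq_or_ne (p i) 0 with h | h
          · simp [h]
          · have := norm_ne_zero_iff.2 h
            field_simp
  calc _ ≤ (∑ i, a i * ‖p i‖ ^ 2) * (80 * ∑ i, a i * ‖p i‖ ^ 2) := by gcongr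
    _ = _ := by ring

/-- Chebyshev's inequality for the part of the error that depends on the residual Gaussian columns
`g`, for fixed vectors `p`. -/
lemma measure_quadratic_form_fluctuation_le {a : Fin d → ℝ} (ha : ∀ i, a i ∈ Set.Icc 0 1)
    (p : Fin d → E) (α : ℝ) {β : Fin d → ℝ} {B : ℝ} (hβ : ∀ j, β j ^ 2 ≤ B * a j)
    {δ : ℝ} (hδ : 0 < δ) :
    (Measure.pi fun _ : Fin d => stdGaussian E)
      {g | δ ≤ |∑ j, (α * (1 - a j) * ∑ i, a i * (inner ℝ (p i) (g j)) ^ 2 +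
          β j * inner ℝ (p j) (g j)) - α * (∑ j, (1 - a j)) * ∑ i, a i * ‖p i‖ ^ 2|} ≤
      ENNReal.ofReal ((160 * α ^ 2 * d * (∑ i, a i * ‖p i‖ ^ 2) ^ 2 +
        2 * B * ∑ i, a i * ‖p i‖ ^ 2) / δ ^ 2) := by
  set T := ∑ i, a i * ‖p i‖ ^ 2 with hT
  set S : E → ℝ := fun x => ∑ i, a i * (inner ℝ (p i) x) ^ 2 with hS
  set X : Fin d → E → ℝ := fun j x => α * (1 - a j) * S x + β j * inner ℝ (p j) x with hX
  have hSm : MemLp S 2 (stdGaussian E) := memLp_weighted_sum_inner_sq a p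
  have hXm (j : Fin d) : MemLp (X j) 2 (stdGaussian E) :=
    (hSm.const_mul _).add ((memLp_inner_stdGaussian (p j)).const_mul _)
  have hmean (j : Fin d) : ∫ x, X j x ∂(stdGaussian E) = α * (1 - a j) * T := by
    rw [integral_add ((hSm.integrable (by norm_num)).const_mul _)
      (((memLp_inner_stdGaussian (p j)).integrable (by norm_num)).const_mul _),
      integral_const_mul, integral_const_mul, integral_inner_stdGaussian,
      integral_weighted_sum_inner_sq, mul_zero, add_zero]
  have hvar (j : Fin d) : Var[X j; stdGaussian E] ≤
      160 * α ^ 2 * T ^ 2 + 2 * B * (a j * ‖p j‖ ^ 2) := by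
    have hpt (x : E) : (X j x) ^ 2 ≤
        2 * α ^ 2 * (S x) ^ 2 + 2 * β j ^ 2 * (inner ℝ (p j) x) ^ 2 := by
      have h1 : (α * (1 - a j)) ^ 2 ≤ α ^ 2 := by
        rw [mul_pow]
        refine mul_le_of_le_one_right (sq_nonneg _) ?_
        have := ha j
        nlinarith [this.1, this.2]
      have h2 := mul_le_mul_of_nonneg_right h1 (sq_nonneg (S x))
      have h3 := sq_nonneg (α * (1 - a j) * S x - β j * inner ℝ (p j) x)
      simp only [hX]
      nlinarith
    have hI1 : Integrable (fun x => 2 * α ^ 2 * (S x) ^ 2) (stdGaussian E) :=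
      hSm.integrable_sq.const_mul _
    have hI2 : Integrable (fun x => 2 * β j ^ 2 * (inner ℝ (p j) x) ^ 2) (stdGaussian E) :=
      (integrable_inner_pow_stdGaussian (p j) 2).const_mul _
    refine (variance_le_expectation_sq (hXm j).aestronglyMeasurable).trans ?_
    refine (integral_mono (hXm j).integrable_sq (hI1.add hI2) hpt).trans ?_
    simp only [Pi.add_apply]
    rw [integral_add hI1 hI2, integral_const_mul, integral_const_mul,
      integral_inner_sq_stdGaussian]
    have h1 := integral_weighted_sum_inner_sq_sq_le (fun i => (ha i).1) p
    have h2 := mul_le_mul_of_nonneg_left h1 (show 0 ≤ 2 * α ^ 2 by positivity)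
    have h3 := mul_le_mul_of_nonneg_right (hβ j) (sq_nonneg ‖p j‖)
    linarith
  have hsumm : MemLp (fun g : Fin d → E => ∑ j, X j (g j)) 2
      (Measure.pi fun _ : Fin d => stdGaussian E) :=
    memLp_finsetSum _ fun j _ => (hXm j).comp_measurePreserving (measurePreserving_eval _ j)
  have hsmean : ∫ g, ∑ j, X j (g j) ∂(Measure.pi fun _ : Fin d => stdGaussian E) =
      α * (∑ j, (1 - a j)) * T := by
    have hint (j : Fin d) : Integrable (fun g : Fin d → E => X j (g j))
        (Measure.pi fun _ => stdGaussian E) :=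
      ((hXm j).comp_measurePreserving (measurePreserving_eval _ j)).integrable (by norm_num)
    rw [integral_finsetSum _ fun j _ => hint j]
    have h (j : Fin d) : ∫ g : Fin d → E, X j (g j) ∂(Measure.pi fun _ => stdGaussian E) =
        α * (1 - a j) * T := by
      rw [integral_comp_eval (μ := fun _ : Fin d => stdGaussian E)
        (hXm j).aestronglyMeasurable, hmean]
    simp_rw [h]
    rw [← Finset.sum_mul, ← Finset.mul_sum]
  have hsvar : Var[fun g : Fin d → E => ∑ j, X j (g j); Measure.pi fun _ => stdGaussian E] ≤
      160 * α ^ 2 * d * T ^ 2 + 2 * B * T := by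
    have h := variance_sum_pi (μ := fun _ : Fin d => stdGaussian E) hXm
    have h2 : (fun g : Fin d → E => ∑ j, X j (g j)) = ∑ j, fun g : Fin d → E => X j (g j) := by
      ext g; simp
    rw [h2, h]
    refine (Finset.sum_le_sum fun j _ => hvar j).trans_eq ?_
    rw [Finset.sum_add_distrib, ← Finset.mul_sum Finset.univ (fun j => a j * ‖p j‖ ^ 2), ← hT,
      Finset.sum_const, Finset.card_univ, Fintype.card_fin, nsmul_eq_mul]
    ring
  have h := meas_ge_le_variance_div_sq hsumm hδ
  rw [hsmean] at h
  refine h.trans (ENNReal.ofReal_le_ofReal ?_)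
  gcongr

end Fluctuations

/-! ### The generalization error as a quadratic form -/

section GenError

lemma posSemidef_scalarCov (d : ℕ) {c : ℝ} (hc : 0 ≤ c) : (scalarCov d c).PosSemidef :=
  Matrix.PosSemidef.one.smul (by positivity)

lemma multivariateGaussian_scalarCov (d : ℕ) {c : ℝ} (hc : 0 ≤ c) :
    multivariateGaussian 0 (scalarCov d c) =
      (stdGaussian (EuclideanSpace ℝ (Fin d))).map (fun x => √(c / d) • x) := by
  have hcd : 0 ≤ c / d := by positivity
  apply Measure.ext_of_charFun
  ext t
  rw [charFun_map_smul, charFun_stdGaussian,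
    charFun_multivariateGaussian (posSemidef_scalarCov d hc), scalarCov, Matrix.smul_mulVec,
    Matrix.one_mulVec, dotProduct_smul, norm_smul, Real.norm_of_nonneg (Real.sqrt_nonneg _)]
  have h1 : t.ofLp ⬝ᵥ t.ofLp = ‖t‖ ^ 2 := by
    rw [EuclideanSpace.real_norm_sq_eq]
    simp [dotProduct, sq]
  have h2 : (√(c / d) * ‖t‖) ^ 2 = c / d * ‖t‖ ^ 2 := by
    rw [mul_pow, Real.sq_sqrt hcd]
  rw [h1, ← Complex.ofReal_pow, h2]
  simp [neg_div]

variable {E : Type*} [NormedAddCommGroup E] [InnerProductSpace ℝ E] [FiniteDimensional ℝ E]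
  [MeasurableSpace E] [BorelSpace E]

lemma integrable_affine_sq_stdGaussian (A r : ℝ) (u : E) :
    Integrable (fun x => (A * inner ℝ u x + r) ^ 2) (stdGaussian E) :=
  (((memLp_inner_stdGaussian u).const_mul A).add (memLp_const r)).integrable_sq

lemma integral_affine_sq_stdGaussian (A r : ℝ) (u : E) :
    ∫ x, (A * inner ℝ u x + r) ^ 2 ∂(stdGaussian E) = A ^ 2 * ‖u‖ ^ 2 + r ^ 2 := by
  have h (x : E) : (A * inner ℝ u x + r) ^ 2 =
      A ^ 2 * (inner ℝ u x) ^ 2 + (2 * A * r) * inner ℝ u x + r ^ 2 := by ring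
  have h1 : Integrable (fun x => A ^ 2 * (inner ℝ u x) ^ 2) (stdGaussian E) :=
    (integrable_inner_pow_stdGaussian u 2).const_mul _
  have h2 : Integrable (fun x => (2 * A * r) * inner ℝ u x) (stdGaussian E) :=
    ((memLp_inner_stdGaussian u).integrable (by norm_num)).const_mul _
  have h12 : Integrable (fun x => A ^ 2 * (inner ℝ u x) ^ 2 + (2 * A * r) * inner ℝ u x)
      (stdGaussian E) := h1.add h2
  simp_rw [h]
  rw [integral_add h12 (integrable_const _), integral_add h1 h2, integral_const_mul,
    integral_const_mul, integral_inner_sq_stdGaussian, integral_inner_stdGaussian]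
  simp

lemma genError_scalarCov {d : ℕ} (hd : 0 < d) {c cz : ℝ} (hc : 0 ≤ c) (hcz : 0 ≤ cz)
    (W : Matrix (Fin d) (Fin d) ℝ) :
    genError (scalarCov d c) (scalarCov d cz) W =
      (c + cz) / d * frobeniusSq W - 2 * c / d * W.trace + c := by
  set w : Fin d → EuclideanSpace ℝ (Fin d) := fun i => WithLp.toLp 2 fun k => W k i with hw
  set u : Fin d → EuclideanSpace ℝ (Fin d) := fun i => w i - EuclideanSpace.single i 1 with hu
  have hcd : 0 ≤ c / d := by positivity
  have hczd : 0 ≤ cz / d := by positivity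
  have hnorm (x z : EuclideanSpace ℝ (Fin d)) :
      ‖Matrix.toEuclideanCLM (𝕜 := ℝ) W.transpose (√(c / d) • x + √(cz / d) • z) -
          √(c / d) • x‖ ^ 2 =
        ∑ i, (√(c / d) * inner ℝ (u i) x + √(cz / d) * inner ℝ (w i) z) ^ 2 := by
    rw [EuclideanSpace.real_norm_sq_eq]
    refine Finset.sum_congr rfl fun i _ => ?_
    congr 1
    have h1 (y : EuclideanSpace ℝ (Fin d)) :
        Matrix.toEuclideanCLM (𝕜 := ℝ) W.transpose y i = inner ℝ (w i) y := by
      simp [hw, PiLp.inner_apply, Matrix.mulVec, dotProduct, mul_comm]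
    simp only [PiLp.sub_apply, h1, inner_add_right, inner_smul_right, hu, inner_sub_left,
      EuclideanSpace.inner_single_left, PiLp.smul_apply, smul_eq_mul, map_one, one_mul]
    ring
  have hw2 (i : Fin d) : ‖w i‖ ^ 2 = ∑ k, W k i ^ 2 := by
    simp [hw, EuclideanSpace.real_norm_sq_eq]
  have hu2 (i : Fin d) : ‖u i‖ ^ 2 = ∑ k, W k i ^ 2 - 2 * W i i + 1 := by
    rw [hu, norm_sub_sq_real, hw2, real_inner_comm, EuclideanSpace.inner_single_left]
    simp [hw]
  have hmeas : ∀ z : EuclideanSpace ℝ (Fin d), Continuous fun x : EuclideanSpace ℝ (Fin d) =>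
      ‖Matrix.toEuclideanCLM (𝕜 := ℝ) W.transpose (x + z) - x‖ ^ 2 := fun z => by fun_prop
  unfold genError
  rw [multivariateGaussian_scalarCov d hc, multivariateGaussian_scalarCov d hcz]
  have hinner (z : EuclideanSpace ℝ (Fin d)) :
      ∫ x, ‖Matrix.toEuclideanCLM (𝕜 := ℝ) W.transpose (x + √(cz / d) • z) - x‖ ^ 2
          ∂((stdGaussian (EuclideanSpace ℝ (Fin d))).map (fun x => √(c / d) • x)) =
        ∑ i, (c / d * ‖u i‖ ^ 2 + (√(cz / d) * inner ℝ (w i) z + 0) ^ 2) := by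
    rw [integral_map (by fun_prop) (hmeas _).aestronglyMeasurable]
    simp_rw [hnorm]
    rw [integral_finsetSum _ fun i _ => integrable_affine_sq_stdGaussian _ _ _]
    simp_rw [integral_affine_sq_stdGaussian, Real.sq_sqrt hcd, add_zero]
  rw [integral_map (by fun_prop) ?_]
  · simp_rw [hinner]
    have hint (i : Fin d) : Integrable
        (fun z => c / d * ‖u i‖ ^ 2 + (√(cz / d) * inner ℝ (w i) z + 0) ^ 2)
        (stdGaussian (EuclideanSpace ℝ (Fin d))) :=
      (integrable_const _).add (integrable_affine_sq_stdGaussian _ _ _)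
    rw [integral_finsetSum _ fun i _ => hint i]
    have h (i : Fin d) : ∫ z, (c / d * ‖u i‖ ^ 2 + (√(cz / d) * inner ℝ (w i) z + 0) ^ 2)
        ∂(stdGaussian (EuclideanSpace ℝ (Fin d))) = c / d * ‖u i‖ ^ 2 + cz / d * ‖w i‖ ^ 2 := by
      rw [integral_add (integrable_const _) (integrable_affine_sq_stdGaussian _ _ _),
        integral_affine_sq_stdGaussian, Real.sq_sqrt hczd]
      simp
    simp_rw [h, hu2, hw2]
    rw [frobeniusSq, Finset.sum_comm, Matrix.trace]
    simp only [Finset.sum_add_distrib, ← Finset.mul_sum, Finset.sum_sub_distrib, Finset.sum_const,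
      Finset.card_univ, Fintype.card_fin, nsmul_eq_mul, mul_one, Matrix.diag_apply]
    have : (d : ℝ) ≠ 0 := by positivity
    field_simp
    ring
  · have hcont : Continuous fun q : EuclideanSpace ℝ (Fin d) × EuclideanSpace ℝ (Fin d) =>
        ‖Matrix.toEuclideanCLM (𝕜 := ℝ) W.transpose (q.2 + q.1) - q.2‖ ^ 2 := by fun_prop
    exact (hcont.stronglyMeasurable.integral_prod_right').aestronglyMeasurable

end GenError

/-! ### A rotated representation of the training data -/

section Law

variable {n d : ℕ}

/-- The training data as a linear function of two independent families `N`, `N'` of standard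
Gaussian columns. The two covariances `U diag(μ) Uᵀ` and `U diag(ν) Uᵀ` are diagonal in a common
orthonormal basis, and in the `j`-th coordinate of that basis the pair (sample, noise) is obtained
from the pair `(N j, N' j)` by a reflection with coefficients `C j`, `S j`, followed by scaling. -/
noncomputable def rotatedSample (n : ℕ) (U : Matrix (Fin d) (Fin d) ℝ) (μ ν C S : Fin d → ℝ) :
    (Fin d → EuclideanSpace ℝ (Fin n)) × (Fin d → EuclideanSpace ℝ (Fin n)) →ₗ[ℝ]
      (Fin n → EuclideanSpace ℝ (Fin d)) × (Fin n → EuclideanSpace ℝ (Fin d)) where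
  toFun p :=
    (fun k => WithLp.toLp 2 fun i => ∑ j, U i j * (√(μ j) * (C j * p.1 j k + S j * p.2 j k)),
     fun k => WithLp.toLp 2 fun i => ∑ j, U i j * (√(ν j) * (S j * p.1 j k - C j * p.2 j k)))
  map_add' p q := by
    ext k i <;> simp [← Finset.sum_add_distrib] <;> refine Finset.sum_congr rfl fun j _ => by ring
  map_smul' r p := by
    ext k i <;> simp [Finset.mul_sum] <;> refine Finset.sum_congr rfl fun j _ => by ring

lemma charFunDual_multivariateGaussian {S : Matrix (Fin d) (Fin d) ℝ} (hS : S.PosSemidef)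
    (L : StrongDual ℝ (EuclideanSpace ℝ (Fin d))) :
    charFunDual (multivariateGaussian 0 S) L =
      Complex.exp (-((fun i => L (EuclideanSpace.single i 1)) ⬝ᵥ
        S.mulVec (fun i => L (EuclideanSpace.single i 1)) : ℝ) / 2) := by
  have h : ((InnerProductSpace.toDual ℝ _).symm L).ofLp =
      fun i => L (EuclideanSpace.single i 1) := by
    ext i
    rw [← InnerProductSpace.toDual_symm_apply (𝕜 := ℝ), real_inner_comm,
      EuclideanSpace.inner_single_left]
    simp
  have hL : L = InnerProductSpace.toDualMap ℝ _ ((InnerProductSpace.toDual ℝ _).symm L) :=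
    ((InnerProductSpace.toDual ℝ _).apply_symm_apply L).symm
  conv_lhs => rw [hL]
  rw [← charFun_eq_charFunDual_toDualMap, charFun_multivariateGaussian hS, h]
  simp [neg_div]

lemma charFunDual_stdGaussian_euclidean (L : StrongDual ℝ (EuclideanSpace ℝ (Fin n))) :
    charFunDual (stdGaussian (EuclideanSpace ℝ (Fin n))) L =
      Complex.exp (-(∑ k, L (EuclideanSpace.single k 1) ^ 2 : ℝ) / 2) := by
  rw [← multivariateGaussian_zero_one, charFunDual_multivariateGaussian .one, Matrix.one_mulVec]
  simp [dotProduct, sq]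

lemma dotProduct_conj_diagonal_mulVec (U : Matrix (Fin d) (Fin d) ℝ) (μ v : Fin d → ℝ) :
    v ⬝ᵥ (U * Matrix.diagonal μ * U.transpose).mulVec v =
      ∑ j, μ j * (∑ i, v i * U i j) ^ 2 := by
  rw [← Matrix.mulVec_mulVec, ← Matrix.mulVec_mulVec, Matrix.dotProduct_mulVec,
    Matrix.mulVec_transpose]
  simp only [dotProduct, Matrix.mulVec_diagonal, Matrix.vecMul]
  exact Finset.sum_congr rfl fun j _ => by ring

lemma dual_apply_eq_sum (L : StrongDual ℝ
      ((Fin n → EuclideanSpace ℝ (Fin d)) × (Fin n → EuclideanSpace ℝ (Fin d))))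
    (y : (Fin n → EuclideanSpace ℝ (Fin d)) × (Fin n → EuclideanSpace ℝ (Fin d))) :
    L y = ∑ k, ∑ i, L (Pi.single k (EuclideanSpace.single i 1), 0) * y.1 k i +
      ∑ k, ∑ i, L (0, Pi.single k (EuclideanSpace.single i 1)) * y.2 k i := by
  have hy : y = ∑ k, ∑ i, y.1 k i • ((Pi.single k (EuclideanSpace.single i 1), 0) :
        (Fin n → EuclideanSpace ℝ (Fin d)) × (Fin n → EuclideanSpace ℝ (Fin d))) +
      ∑ k, ∑ i, y.2 k i • ((0, Pi.single k (EuclideanSpace.single i 1)) :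
        (Fin n → EuclideanSpace ℝ (Fin d)) × (Fin n → EuclideanSpace ℝ (Fin d))) := by
    ext k i
    · simp [Prod.fst_sum, Finset.sum_apply, Pi.single_apply, apply_ite]
    · simp [Prod.snd_sum, Finset.sum_apply, Pi.single_apply, apply_ite]
  conv_lhs => rw [hy]
  simp only [map_add, map_sum, map_smul, smul_eq_mul, mul_comm]

lemma sum_mul_single_apply (f : Fin n → Fin d → ℝ) (k : Fin n) (v : EuclideanSpace ℝ (Fin d)) :
    ∑ l, ∑ i, f l i * (Pi.single k v : Fin n → EuclideanSpace ℝ (Fin d)) l i =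
      ∑ i, f k i * v i := by
  rw [Finset.sum_eq_single k]
  · simp
  · intro l _ hl
    simp [Pi.single_eq_of_ne hl]
  · simp

lemma rotatedSample_single_left (U : Matrix (Fin d) (Fin d) ℝ) (μ ν C S : Fin d → ℝ) (j : Fin d)
    (k : Fin n) :
    rotatedSample n U μ ν C S (Pi.single j (EuclideanSpace.single k 1), 0) =
      (Pi.single k (WithLp.toLp 2 fun i => U i j * (√(μ j) * C j)),
        Pi.single k (WithLp.toLp 2 fun i => U i j * (√(ν j) * S j))) := by
  ext l i
  all_goals
    simp only [rotatedSample, LinearMap.coe_mk, AddHom.coe_mk]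
    rw [Finset.sum_eq_single j (fun j' _ hj' => by simp [Pi.single_eq_of_ne hj']) (by simp)]
    rcases eq_or_ne l k with rfl | hl
    · simp
    · simp [hl]

lemma rotatedSample_single_right (U : Matrix (Fin d) (Fin d) ℝ) (μ ν C S : Fin d → ℝ) (j : Fin d)
    (k : Fin n) :
    rotatedSample n U μ ν C S (0, Pi.single j (EuclideanSpace.single k 1)) =
      (Pi.single k (WithLp.toLp 2 fun i => U i j * (√(μ j) * S j)),
        Pi.single k (WithLp.toLp 2 fun i => - (U i j * (√(ν j) * C j)))) := by
  ext l i
  all_goals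
    simp only [rotatedSample, LinearMap.coe_mk, AddHom.coe_mk]
    rw [Finset.sum_eq_single j (fun j' _ hj' => by simp [Pi.single_eq_of_ne hj']) (by simp)]
    rcases eq_or_ne l k with rfl | hl
    · simp
    · simp [hl]

/-- The law of the training data does not depend on the reflection, by rotation invariance of the
planar standard Gaussian measure. -/
lemma map_rotatedSample {U : Matrix (Fin d) (Fin d) ℝ} {μ ν C S : Fin d → ℝ}
    (hμ : ∀ j, 0 ≤ μ j) (hν : ∀ j, 0 ≤ ν j) (hCS : ∀ j, C j ^ 2 + S j ^ 2 = 1)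
    (hS : (U * Matrix.diagonal μ * U.transpose).PosSemidef)
    (hS₁ : (U * Matrix.diagonal ν * U.transpose).PosSemidef) :
    ((Measure.pi fun _ : Fin d => stdGaussian (EuclideanSpace ℝ (Fin n))).prod
      (Measure.pi fun _ : Fin d => stdGaussian (EuclideanSpace ℝ (Fin n)))).map
        (rotatedSample n U μ ν C S) =
      trainingLaw n (U * Matrix.diagonal μ * U.transpose)
        (U * Matrix.diagonal ν * U.transpose) := by
  set Φ := LinearMap.toContinuousLinearMap (rotatedSample n U μ ν C S) with hΦ
  have hΦc : ⇑(rotatedSample n U μ ν C S) = ⇑Φ := rfl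
  rw [hΦc]
  unfold trainingLaw
  apply Measure.ext_of_charFunDual
  ext L
  rw [charFunDual_map, charFunDual_prod, charFunDual_prod, charFunDual_pi, charFunDual_pi,
    charFunDual_pi, charFunDual_pi]
  simp_rw [charFunDual_stdGaussian_euclidean, charFunDual_multivariateGaussian hS,
    charFunDual_multivariateGaussian hS₁, dotProduct_conj_diagonal_mulVec]
  simp_rw [← Complex.exp_sum]
  rw [← Complex.exp_add, ← Complex.exp_add]
  congr 1
  simp_rw [← Finset.sum_div, Finset.sum_neg_distrib, ← Complex.ofReal_sum]
  rw [← add_div, ← add_div, ← neg_add, ← neg_add, ← Complex.ofReal_add, ← Complex.ofReal_add]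
  congr 3
  set P : Fin n → Fin d → ℝ := fun k j =>
    ∑ i, L (Pi.single k (EuclideanSpace.single i 1), 0) * U i j with hP
  set Q : Fin n → Fin d → ℝ := fun k j =>
    ∑ i, L (0, Pi.single k (EuclideanSpace.single i 1)) * U i j with hQ
  have h1 (j : Fin d) (k : Fin n) : L (Φ (Pi.single j (EuclideanSpace.single k 1), 0)) =
      √(μ j) * C j * P k j + √(ν j) * S j * Q k j := by
    rw [← hΦc, rotatedSample_single_left, dual_apply_eq_sum, sum_mul_single_apply,
      sum_mul_single_apply]
    simp only [hP, hQ, Finset.mul_sum]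
    congr 1 <;> exact Finset.sum_congr rfl fun i _ => by ring
  have h2 (j : Fin d) (k : Fin n) : L (Φ (0, Pi.single j (EuclideanSpace.single k 1))) =
      √(μ j) * S j * P k j - √(ν j) * C j * Q k j := by
    rw [← hΦc, rotatedSample_single_right, dual_apply_eq_sum, sum_mul_single_apply,
      sum_mul_single_apply, sub_eq_add_neg]
    simp only [hP, hQ, Finset.mul_sum, ← Finset.sum_neg_distrib]
    congr 1 <;> exact Finset.sum_congr rfl fun i _ => by ring
  simp only [ContinuousLinearMap.comp_apply, ContinuousLinearMap.inl_apply,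
    ContinuousLinearMap.inr_apply, ContinuousLinearMap.single_apply]
  simp only [h1, h2]
  calc _ = ∑ j, ∑ k, (μ j * P k j ^ 2 + ν j * Q k j ^ 2) := by
        rw [← Finset.sum_add_distrib]
        refine Finset.sum_congr rfl fun j _ => ?_
        rw [← Finset.sum_add_distrib]
        refine Finset.sum_congr rfl fun k _ => ?_
        have e1 := Real.sq_sqrt (hμ j)
        have e2 := Real.sq_sqrt (hν j)
        have e3 := hCS j
        linear_combination (C j ^ 2 + S j ^ 2) * P k j ^ 2 * e1 +
          (C j ^ 2 + S j ^ 2) * Q k j ^ 2 * e2 + (μ j * P k j ^ 2 + ν j * Q k j ^ 2) * e3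
    _ = _ := by
        rw [Finset.sum_comm, ← Finset.sum_add_distrib]
        exact Finset.sum_congr rfl fun k _ => Finset.sum_add_distrib

end Law

/-! ### Least-squares denoisers in rotated coordinates -/

section LeastSquares

variable {n d : ℕ}

lemma frobeniusSq_eq_trace (A : Matrix (Fin n) (Fin d) ℝ) :
    frobeniusSq A = (A.transpose * A).trace := by
  simp only [frobeniusSq, Matrix.trace, Matrix.diag_apply, Matrix.mul_apply,
    Matrix.transpose_apply]
  rw [Finset.sum_comm]
  simp [sq]

lemma eq_zero_of_frobeniusSq_eq_zero {A : Matrix (Fin n) (Fin d) ℝ} (h : frobeniusSq A = 0) :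
    A = 0 := by
  ext i j
  have h1 := (Finset.sum_eq_zero_iff_of_nonneg fun i _ =>
    Finset.sum_nonneg fun j _ => sq_nonneg (A i j)).1 h i (Finset.mem_univ i)
  have h2 := (Finset.sum_eq_zero_iff_of_nonneg fun j _ => sq_nonneg (A i j)).1 h1 j
    (Finset.mem_univ j)
  simpa using h2

/-- The normal equations `Yᵀ Y W = Yᵀ X` of the least-squares problem, with `Y = X + Z` the noisy
data matrix. -/
def SatisfiesNormalEquations
    (ω : (Fin n → EuclideanSpace ℝ (Fin d)) × (Fin n → EuclideanSpace ℝ (Fin d)))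
    (W : Matrix (Fin d) (Fin d) ℝ) : Prop :=
  ((dataMatrix ω.1 + dataMatrix ω.2).transpose * (dataMatrix ω.1 + dataMatrix ω.2)) * W =
    (dataMatrix ω.1 + dataMatrix ω.2).transpose * dataMatrix ω.1

/-- A minimizer satisfies the normal equations, as is seen by moving `W` in the direction of the
gradient. -/
lemma IsLeastSquaresDenoiser.satisfiesNormalEquations
    {ω : (Fin n → EuclideanSpace ℝ (Fin d)) × (Fin n → EuclideanSpace ℝ (Fin d))}
    {W : Matrix (Fin d) (Fin d) ℝ} (hW : IsLeastSquaresDenoiser ω W) :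
    SatisfiesNormalEquations ω W := by
  unfold SatisfiesNormalEquations
  set Y := dataMatrix ω.1 + dataMatrix ω.2 with hY
  set R := Y * W - dataMatrix ω.1 with hR
  set V := Y.transpose * R with hV
  have hexp (t : ℝ) : frobeniusSq (Y * (W + t • V) - dataMatrix ω.1) =
      frobeniusSq R + 2 * t * frobeniusSq V + t ^ 2 * frobeniusSq (Y * V) := by
    have h1 : Y * (W + t • V) - dataMatrix ω.1 = R + t • (Y * V) := by
      rw [hR, Matrix.mul_add, Matrix.mul_smul]; abel
    have h2 : ((Y * V).transpose * R).trace = frobeniusSq V := by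
      rw [frobeniusSq_eq_trace, Matrix.transpose_mul, Matrix.mul_assoc, ← hV]
    have h3 : (R.transpose * (Y * V)).trace = frobeniusSq V := by
      rw [← h2, ← Matrix.trace_transpose, Matrix.transpose_mul, Matrix.transpose_transpose]
    rw [h1, frobeniusSq_eq_trace, frobeniusSq_eq_trace R, frobeniusSq_eq_trace (Y * V)]
    simp only [Matrix.transpose_add, Matrix.transpose_smul, Matrix.add_mul, Matrix.mul_add,
      Matrix.smul_mul, Matrix.mul_smul, Matrix.trace_add, Matrix.trace_smul, smul_eq_mul, h2, h3]
    ring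
  have hV0 : frobeniusSq V = 0 := by
    have hnn : 0 ≤ frobeniusSq V :=
      Finset.sum_nonneg fun i _ => Finset.sum_nonneg fun j _ => sq_nonneg _
    have hq : 0 ≤ frobeniusSq (Y * V) :=
      Finset.sum_nonneg fun i _ => Finset.sum_nonneg fun j _ => sq_nonneg _
    have hmin (t : ℝ) : 0 ≤ 2 * t * frobeniusSq V + t ^ 2 * frobeniusSq (Y * V) := by
      have := hW (W + t • V)
      rw [← hY, hexp, ← hR] at this
      linarith
    -- At `t = -v / (q + 1)` the quadratic `2 t v + t² q` is at most `-v² / (q + 1)`.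
    have h := hmin (-(frobeniusSq V / (frobeniusSq (Y * V) + 1)))
    set v := frobeniusSq V
    set q := frobeniusSq (Y * V)
    have hq1 : 0 < q + 1 := by linarith
    have h2 : 2 * -(v / (q + 1)) * v + (-(v / (q + 1))) ^ 2 * q =
        - (v ^ 2 * (q + 2)) / (q + 1) ^ 2 := by
      field_simp; ring
    rw [h2] at h
    by_contra hv
    have : 0 < v ^ 2 * (q + 2) / (q + 1) ^ 2 := by positivity
    rw [neg_div] at h
    linarith
  have h := eq_zero_of_frobeniusSq_eq_zero hV0
  rw [hV, hR, Matrix.mul_sub, sub_eq_zero] at h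
  rw [Matrix.mul_assoc, h]

/-- The matrix whose columns are the vectors `N j`. -/
def columnMatrix (N : Fin d → EuclideanSpace ℝ (Fin n)) : Matrix (Fin n) (Fin d) ℝ :=
  Matrix.of fun k j => N j k

lemma columnMatrix_transpose_mul (N : Fin d → EuclideanSpace ℝ (Fin n)) :
    (columnMatrix N).transpose * columnMatrix N = Matrix.gram ℝ N := by
  ext i j
  simp [columnMatrix, Matrix.mul_apply, PiLp.inner_apply, mul_comm]

lemma dataMatrix_rotatedSample_fst (U : Matrix (Fin d) (Fin d) ℝ) (μ ν C S : Fin d → ℝ)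
    (p : (Fin d → EuclideanSpace ℝ (Fin n)) × (Fin d → EuclideanSpace ℝ (Fin n))) :
    dataMatrix (rotatedSample n U μ ν C S p).1 =
      (columnMatrix p.1 * Matrix.diagonal (fun j => √(μ j) * C j) +
        columnMatrix p.2 * Matrix.diagonal (fun j => √(μ j) * S j)) * U.transpose := by
  ext k i
  rw [Matrix.mul_apply]
  simp only [dataMatrix, rotatedSample, columnMatrix, LinearMap.coe_mk, AddHom.coe_mk,
    Matrix.of_apply, Matrix.add_apply, Matrix.mul_diagonal, Matrix.transpose_apply]
  exact Finset.sum_congr rfl fun j _ => by ring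

lemma dataMatrix_rotatedSample_snd (U : Matrix (Fin d) (Fin d) ℝ) (μ ν C S : Fin d → ℝ)
    (p : (Fin d → EuclideanSpace ℝ (Fin n)) × (Fin d → EuclideanSpace ℝ (Fin n))) :
    dataMatrix (rotatedSample n U μ ν C S p).2 =
      (columnMatrix p.1 * Matrix.diagonal (fun j => √(ν j) * S j) -
        columnMatrix p.2 * Matrix.diagonal (fun j => √(ν j) * C j)) * U.transpose := by
  ext k i
  rw [Matrix.mul_apply]
  simp only [dataMatrix, rotatedSample, columnMatrix, LinearMap.coe_mk, AddHom.coe_mk,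
    Matrix.of_apply, Matrix.sub_apply, Matrix.mul_diagonal, Matrix.transpose_apply]
  exact Finset.sum_congr rfl fun j _ => by ring

/-- The `i`-th row of the pseudo-inverse of the matrix with columns `N j`: the dual basis of the
family `N` in its span. -/
noncomputable def dualVector (N : Fin d → EuclideanSpace ℝ (Fin n)) (i : Fin d) :
    EuclideanSpace ℝ (Fin n) :=
  ∑ l, (Matrix.gram ℝ N)⁻¹ i l • N l

lemma norm_dualVector_sq {N : Fin d → EuclideanSpace ℝ (Fin n)} (hN : LinearIndependent ℝ N)
    (i : Fin d) : ‖dualVector N i‖ ^ 2 = (Matrix.gram ℝ N)⁻¹ i i := by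
  have hdet : IsUnit (Matrix.gram ℝ N).det :=
    isUnit_iff_ne_zero.2 (Matrix.det_gram_ne_zero_iff_linearIndependent.2 hN)
  have hsymm : ((Matrix.gram ℝ N)⁻¹).transpose = (Matrix.gram ℝ N)⁻¹ := by
    rw [Matrix.transpose_nonsing_inv]
    congr 1
    ext i j
    simp [real_inner_comm]
  have h : ‖dualVector N i‖ ^ 2 =
      ((Matrix.gram ℝ N)⁻¹ * Matrix.gram ℝ N * ((Matrix.gram ℝ N)⁻¹).transpose) i i := by
    rw [← real_inner_self_eq_norm_sq, dualVector, sum_inner]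
    simp only [inner_sum, inner_smul_left, inner_smul_right, Matrix.mul_apply,
      Matrix.transpose_apply, Matrix.gram_apply, Finset.sum_mul]
    rw [Finset.sum_comm]
    exact Finset.sum_congr rfl fun _ _ => Finset.sum_congr rfl fun _ _ => by simp; ring
  rw [h, Matrix.nonsing_inv_mul _ hdet, Matrix.one_mul, hsymm]

lemma inv_gram_mul_columnMatrix_apply (N N' : Fin d → EuclideanSpace ℝ (Fin n)) (i j : Fin d) :
    ((Matrix.gram ℝ N)⁻¹ * ((columnMatrix N).transpose * columnMatrix N')) i j =
      inner ℝ (dualVector N i) (N' j) := by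
  rw [dualVector, sum_inner, Matrix.mul_apply]
  refine Finset.sum_congr rfl fun l _ => ?_
  simp [columnMatrix, Matrix.mul_apply, PiLp.inner_apply, inner_smul_left, mul_comm]

/-- The shrinkage factors `a j = s / (s + ν j)`: the best linear predictor of the `j`-th coordinate
of a sample with variance `s` from the same coordinate with noise of variance `ν j` added. -/
noncomputable def shrinkage (s : ℝ) (ν : Fin d → ℝ) (j : Fin d) : ℝ := s / (s + ν j)

lemma shrinkage_mem_Icc {s : ℝ} (hs : 0 < s) {ν : Fin d → ℝ} (hν : ∀ j, 0 ≤ ν j) (j : Fin d) :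
    shrinkage s ν j ∈ Set.Icc 0 1 := by
  have := hν j
  refine ⟨by unfold shrinkage; positivity, ?_⟩
  unfold shrinkage
  rw [div_le_one (by positivity)]
  linarith

/-- The noisy data matrix involves the first Gaussian family only; the reflection coefficients
`√a j`, `√(1 - a j)` are chosen to this end. -/
lemma noisy_dataMatrix_rotatedSample {U : Matrix (Fin d) (Fin d) ℝ} {s : ℝ} (hs : 0 < s)
    {ν : Fin d → ℝ} (hν : ∀ j, 0 ≤ ν j)
    (p : (Fin d → EuclideanSpace ℝ (Fin n)) × (Fin d → EuclideanSpace ℝ (Fin n))) :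
    dataMatrix (rotatedSample n U (fun _ => s) ν (fun j => √(shrinkage s ν j))
        (fun j => √(1 - shrinkage s ν j)) p).1 +
      dataMatrix (rotatedSample n U (fun _ => s) ν (fun j => √(shrinkage s ν j))
        (fun j => √(1 - shrinkage s ν j)) p).2 =
      columnMatrix p.1 * Matrix.diagonal (fun j => √(s + ν j)) * U.transpose := by
  have h1 (j : Fin d) : √s * √(shrinkage s ν j) + √(ν j) * √(1 - shrinkage s ν j) =
      √(s + ν j) := by
    have hb : 0 < s + ν j := by linarith [hν j]
    have e : 1 - shrinkage s ν j = ν j / (s + ν j) := by unfold shrinkage; field_simp; ring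
    rw [e, shrinkage, Real.sqrt_div hs.le, Real.sqrt_div (hν j)]
    have := Real.sqrt_pos.2 hb
    field_simp
    rw [Real.sq_sqrt hs.le, Real.sq_sqrt (hν j), Real.sq_sqrt hb.le]
  have h2 (j : Fin d) : √s * √(1 - shrinkage s ν j) = √(ν j) * √(shrinkage s ν j) := by
    have hb : 0 < s + ν j := by linarith [hν j]
    have e : 1 - shrinkage s ν j = ν j / (s + ν j) := by unfold shrinkage; field_simp; ring
    rw [e, shrinkage, Real.sqrt_div hs.le, Real.sqrt_div (hν j)]
    ring
  rw [dataMatrix_rotatedSample_fst, dataMatrix_rotatedSample_snd, ← Matrix.add_mul]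
  congr 1
  simp only [h2]
  rw [add_add_sub_cancel, ← Matrix.mul_add, Matrix.diagonal_add]
  simp only [h1]

lemma det_noisy_gram_ne_zero {U : Matrix (Fin d) (Fin d) ℝ} (hU : U.transpose * U = 1) {s : ℝ}
    (hs : 0 < s) {ν : Fin d → ℝ} (hν : ∀ j, 0 ≤ ν j)
    {p : (Fin d → EuclideanSpace ℝ (Fin n)) × (Fin d → EuclideanSpace ℝ (Fin n))}
    (hN : LinearIndependent ℝ p.1)
    {ω : (Fin n → EuclideanSpace ℝ (Fin d)) × (Fin n → EuclideanSpace ℝ (Fin d))}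
    (hω : ω = rotatedSample n U (fun _ => s) ν (fun j => √(shrinkage s ν j))
        (fun j => √(1 - shrinkage s ν j)) p) :
    ((dataMatrix ω.1 + dataMatrix ω.2).transpose * (dataMatrix ω.1 + dataMatrix ω.2)).det ≠ 0 := by
  rw [hω, noisy_dataMatrix_rotatedSample hs hν]
  set Di := Matrix.diagonal fun j => √(s + ν j)
  have h : (columnMatrix p.1 * Di * U.transpose).transpose *
      (columnMatrix p.1 * Di * U.transpose) =
      U * (Di * (Matrix.gram ℝ p.1 * (Di * U.transpose))) := by
    rw [← columnMatrix_transpose_mul]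
    simp only [Matrix.transpose_mul, Matrix.transpose_transpose, Di, Matrix.diagonal_transpose,
      Matrix.mul_assoc]
  have hdetU : U.det ≠ 0 := fun h0 => by
    have := congrArg Matrix.det hU
    simp [h0] at this
  have hdetD : Di.det ≠ 0 := by
    rw [Matrix.det_diagonal]
    exact Finset.prod_ne_zero_iff.2 fun j _ => (Real.sqrt_pos.2 (by linarith [hν j])).ne'
  rw [h, Matrix.det_mul, Matrix.det_mul, Matrix.det_mul, Matrix.det_mul, Matrix.det_transpose]
  have hG := Matrix.det_gram_ne_zero_iff_linearIndependent.2 hN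
  positivity

/-- In the eigenbasis of the noise, a solution of the normal equations is the diagonal matrix of
shrinkage factors plus a matrix which, given the noisy data, is centered Gaussian. -/
lemma SatisfiesNormalEquations.conj_apply {U : Matrix (Fin d) (Fin d) ℝ}
    (hU : U.transpose * U = 1) {s : ℝ} (hs : 0 < s) {ν : Fin d → ℝ} (hν : ∀ j, 0 ≤ ν j)
    {p : (Fin d → EuclideanSpace ℝ (Fin n)) × (Fin d → EuclideanSpace ℝ (Fin n))}
    (hN : LinearIndependent ℝ p.1) {W : Matrix (Fin d) (Fin d) ℝ}
    (hW : SatisfiesNormalEquations (rotatedSample n U (fun _ => s) ν (fun j => √(shrinkage s ν j))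
        (fun j => √(1 - shrinkage s ν j)) p) W) (i j : Fin d) :
    (U.transpose * W * U) i j = (if i = j then shrinkage s ν i else 0) +
      √(shrinkage s ν i) * √(1 - shrinkage s ν j) * inner ℝ (dualVector p.1 i) (p.2 j) := by
  have hU' : U * U.transpose = 1 := mul_eq_one_comm.1 hU
  have hdet : IsUnit (Matrix.gram ℝ p.1).det :=
    isUnit_iff_ne_zero.2 (Matrix.det_gram_ne_zero_iff_linearIndependent.2 hN)
  have hne := hW
  unfold SatisfiesNormalEquations at hne
  rw [noisy_dataMatrix_rotatedSample hs hν, dataMatrix_rotatedSample_fst] at hne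
  set b : Fin d → ℝ := fun j => √(s + ν j) with hb
  have hb0 (j : Fin d) : 0 < b j := Real.sqrt_pos.2 (by linarith [hν j])
  set Di := Matrix.diagonal b
  set Dinv := Matrix.diagonal fun j => (b j)⁻¹
  have hDD : Dinv * Di = 1 := by
    rw [Matrix.diagonal_mul_diagonal, ← Matrix.diagonal_one]
    congr 1
    ext j
    exact inv_mul_cancel₀ (hb0 j).ne'
  set G := Matrix.gram ℝ p.1
  have hGG : G⁻¹ * G = 1 := Matrix.nonsing_inv_mul _ hdet
  have hDt : Di.transpose = Di := Matrix.diagonal_transpose _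
  set A := Matrix.diagonal fun j => √s * √(shrinkage s ν j) with hA
  set A' := Matrix.diagonal fun j => √s * √(1 - shrinkage s ν j) with hA'
  set M := columnMatrix p.1
  set M' := columnMatrix p.2
  have hG : M.transpose * M = G := columnMatrix_transpose_mul p.1
  have hkey : U.transpose * W * U = Dinv * (A + G⁻¹ * (M.transpose * M') * A') := by
    have h1 : U * (Di * (G * (Di * (U.transpose * W)))) =
        U * (Di * ((G * A + (M.transpose * M') * A') * U.transpose)) := by
      have : (M * Di * U.transpose).transpose * (M * Di * U.transpose) * W =
          U * (Di * ((M.transpose * M) * (Di * (U.transpose * W)))) := by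
        simp only [Matrix.transpose_mul, Matrix.transpose_transpose, hDt, Matrix.mul_assoc]
      rw [← hG, ← this, hne]
      simp only [Matrix.transpose_mul, Matrix.transpose_transpose, hDt, Matrix.mul_assoc,
        Matrix.add_mul, Matrix.mul_add]
    have cancel {Z Z' : Matrix (Fin d) (Fin d) ℝ} (Q : Matrix (Fin d) (Fin d) ℝ)
        (Qi : Matrix (Fin d) (Fin d) ℝ) (hQ : Qi * Q = 1) (h : Q * Z = Z') : Z = Qi * Z' := by
      rw [← h, ← Matrix.mul_assoc, hQ, Matrix.one_mul]
    have h2 := cancel _ _ hU h1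
    rw [← Matrix.mul_assoc U.transpose, hU, Matrix.one_mul] at h2
    have h3 := cancel _ _ hDD h2
    rw [← Matrix.mul_assoc Dinv, hDD, Matrix.one_mul] at h3
    have h4 := cancel _ _ hDD (cancel _ _ hGG h3)
    rw [h4]
    simp only [Matrix.mul_assoc, Matrix.mul_add, Matrix.add_mul, hU, Matrix.mul_one]
    rw [← Matrix.mul_assoc G⁻¹ G, hGG, Matrix.one_mul]
  have hsb (i : Fin d) : (b i)⁻¹ * √s = √(shrinkage s ν i) := by
    rw [shrinkage, Real.sqrt_div hs.le, hb]
    field_simp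
  rw [hkey, Matrix.diagonal_mul, Matrix.add_apply, Matrix.mul_diagonal,
    inv_gram_mul_columnMatrix_apply, mul_add, ← hsb i]
  congr 1
  · rw [hA, Matrix.diagonal_apply]
    split_ifs
    · rw [← mul_assoc, hsb, Real.mul_self_sqrt (shrinkage_mem_Icc hs hν i).1]
    · simp
  · ring

lemma trace_conj {U : Matrix (Fin d) (Fin d) ℝ} (hU : U.transpose * U = 1)
    (W : Matrix (Fin d) (Fin d) ℝ) : (U.transpose * W * U).trace = W.trace := by
  rw [Matrix.trace_mul_comm, ← Matrix.mul_assoc, mul_eq_one_comm.1 hU, Matrix.one_mul]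

lemma frobeniusSq_conj {U : Matrix (Fin d) (Fin d) ℝ} (hU : U.transpose * U = 1)
    (W : Matrix (Fin d) (Fin d) ℝ) : frobeniusSq (U.transpose * W * U) = frobeniusSq W := by
  rw [frobeniusSq_eq_trace, frobeniusSq_eq_trace, ← trace_conj hU (W.transpose * W)]
  congr 1
  simp only [Matrix.transpose_mul, Matrix.transpose_transpose, Matrix.mul_assoc]
  rw [← Matrix.mul_assoc U U.transpose, mul_eq_one_comm.1 hU, Matrix.one_mul]

/-- The generalization error of a solution of the normal equations in terms of the two Gaussian
families. -/
lemma SatisfiesNormalEquations.genError_eq (hd : 0 < d) {c cz : ℝ} (hc : 0 < c) (hcz : 0 ≤ cz)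
    {U : Matrix (Fin d) (Fin d) ℝ} (hU : U.transpose * U = 1) {s : ℝ} (hs : 0 < s)
    {ν : Fin d → ℝ} (hν : ∀ j, 0 ≤ ν j)
    {p : (Fin d → EuclideanSpace ℝ (Fin n)) × (Fin d → EuclideanSpace ℝ (Fin n))}
    (hN : LinearIndependent ℝ p.1) {W : Matrix (Fin d) (Fin d) ℝ}
    (hW : SatisfiesNormalEquations (rotatedSample n U (fun _ => s) ν (fun j => √(shrinkage s ν j))
        (fun j => √(1 - shrinkage s ν j)) p) W) :
    genError (scalarCov d c) (scalarCov d cz) W =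
      (c + cz) * ((∑ i, shrinkage s ν i ^ 2) / d) - 2 * c * ((∑ i, shrinkage s ν i) / d) + c +
      (∑ j, ((c + cz) * (1 - shrinkage s ν j) *
          ∑ i, shrinkage s ν i * (inner ℝ (dualVector p.1 i) (p.2 j)) ^ 2 +
        √(shrinkage s ν j) * √(1 - shrinkage s ν j) * (2 * (c + cz) * shrinkage s ν j - 2 * c) *
          inner ℝ (dualVector p.1 j) (p.2 j))) / d := by
  have hent := hW.conj_apply hU hs hν hN
  set a := shrinkage s ν with ha
  have ha01 := shrinkage_mem_Icc hs hν
  rw [← ha] at ha01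
  set H : Fin d → Fin d → ℝ := fun i j => inner ℝ (dualVector p.1 i) (p.2 j) with hH
  have htr : W.trace = ∑ i, a i + ∑ i, √(a i) * √(1 - a i) * H i i := by
    rw [← trace_conj hU W, Matrix.trace, ← Finset.sum_add_distrib]
    exact Finset.sum_congr rfl fun i _ => by rw [Matrix.diag_apply, hent]; simp [hH]
  have hfr : frobeniusSq W = ∑ i, a i ^ 2 + ∑ i, 2 * a i * (√(a i) * √(1 - a i)) * H i i +
      ∑ j, (1 - a j) * ∑ i, a i * H i j ^ 2 := by
    rw [← frobeniusSq_conj hU W, frobeniusSq]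
    have h1 (i j : Fin d) : (U.transpose * W * U) i j ^ 2 =
        (if i = j then a i ^ 2 + 2 * a i * (√(a i) * √(1 - a i)) * H i i else 0) +
          (1 - a j) * (a i * H i j ^ 2) := by
      have e1 := Real.sq_sqrt (ha01 i).1
      have e2 := Real.sq_sqrt (sub_nonneg.2 (ha01 j).2)
      rw [hent]
      split_ifs with hij
      · subst hij
        linear_combination (1 - a i) * H i i ^ 2 * e1 + √(a i) ^ 2 * H i i ^ 2 * e2
      · linear_combination (1 - a j) * H i j ^ 2 * e1 + √(a i) ^ 2 * H i j ^ 2 * e2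
    simp_rw [h1, Finset.sum_add_distrib, Finset.sum_ite_eq, Finset.mem_univ, if_true]
    rw [Finset.sum_add_distrib, Finset.sum_comm (f := fun i j => (1 - a j) * (a i * H i j ^ 2))]
    simp_rw [Finset.mul_sum]
  rw [genError_scalarCov hd hc.le hcz, htr, hfr, Finset.sum_add_distrib]
  have hlin : ∑ j, √(a j) * √(1 - a j) * (2 * (c + cz) * a j - 2 * c) * H j j =
      (c + cz) * ∑ i, 2 * a i * (√(a i) * √(1 - a i)) * H i i -
        2 * c * ∑ i, √(a i) * √(1 - a i) * H i i := by
    rw [Finset.mul_sum, Finset.mul_sum, ← Finset.sum_sub_distrib]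
    exact Finset.sum_congr rfl fun j _ => by ring
  have hquad : ∑ j, (c + cz) * (1 - a j) * ∑ i, a i * H i j ^ 2 =
      (c + cz) * ∑ j, (1 - a j) * ∑ i, a i * H i j ^ 2 := by
    rw [Finset.mul_sum]
    exact Finset.sum_congr rfl fun j _ => by ring
  rw [hlin, hquad]
  ring

end LeastSquares

/-! ### Concentration of the generalization error -/

section Concentration

open scoped ENNReal

variable {n d : ℕ}

lemma continuous_dataMatrix :
    Continuous fun x : Fin n → EuclideanSpace ℝ (Fin d) => dataMatrix x :=
  continuous_matrix fun i j => by
    simp only [dataMatrix, Matrix.of_apply]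
    fun_prop

lemma continuous_noisy_dataMatrix :
    Continuous fun ω : (Fin n → EuclideanSpace ℝ (Fin d)) × (Fin n → EuclideanSpace ℝ (Fin d)) =>
      dataMatrix ω.1 + dataMatrix ω.2 :=
  (continuous_dataMatrix.comp continuous_fst).add (continuous_dataMatrix.comp continuous_snd)

/-- The least-squares denoiser given by the normal equations, when the noisy Gram matrix is
invertible. -/
noncomputable def leastSquaresMatrix
    (ω : (Fin n → EuclideanSpace ℝ (Fin d)) × (Fin n → EuclideanSpace ℝ (Fin d))) :
    Matrix (Fin d) (Fin d) ℝ :=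
  ((dataMatrix ω.1 + dataMatrix ω.2).transpose * (dataMatrix ω.1 + dataMatrix ω.2))⁻¹ *
    ((dataMatrix ω.1 + dataMatrix ω.2).transpose * dataMatrix ω.1)

lemma measurable_leastSquaresMatrix (i j : Fin d) :
    Measurable fun ω : (Fin n → EuclideanSpace ℝ (Fin d)) × (Fin n → EuclideanSpace ℝ (Fin d)) =>
      leastSquaresMatrix ω i j := by
  have hY := continuous_noisy_dataMatrix (n := n) (d := d)
  have hG := hY.matrix_transpose.matrix_mul hY
  have hA := hG.matrix_adjugate.matrix_mul
    (hY.matrix_transpose.matrix_mul (continuous_dataMatrix.comp continuous_fst))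
  simp only [leastSquaresMatrix, Matrix.inv_def, Matrix.smul_mul, Matrix.smul_apply,
    Ring.inverse_eq_inv', smul_eq_mul]
  exact hG.matrix_det.measurable.inv.mul (hA.matrix_elem i j).measurable

lemma measurable_genError_leastSquaresMatrix (hd : 0 < d) {c cz : ℝ} (hc : 0 ≤ c) (hcz : 0 ≤ cz) :
    Measurable fun ω : (Fin n → EuclideanSpace ℝ (Fin d)) × (Fin n → EuclideanSpace ℝ (Fin d)) =>
      genError (scalarCov d c) (scalarCov d cz) (leastSquaresMatrix ω) := by
  simp_rw [genError_scalarCov hd hc hcz, frobeniusSq, Matrix.trace, Matrix.diag_apply]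
  have h := measurable_leastSquaresMatrix (n := n) (d := d)
  fun_prop

/-- The value around which the generalization error concentrates, in terms of the mean `s` and the
mean square `q` of the shrinkage factors. The parameter `r` is `d / (n - d + 1)` at finite size and
`1 / (κ - 1)` in the limit. -/
def averagedError (c cz r s q : ℝ) : ℝ :=
  (c + cz) * (q + (1 - s) * (s * r)) - 2 * c * s + c

/-- The error is compared with the value around which it concentrates. It deviates because
of the weighted trace of the inverse Gram matrix, or because of the fluctuations of the residual
family given the noisy data; the two parts of the bound correspond to these. -/
lemma measure_genError_deviation_le (hd : 0 < d) {m : ℕ} (hm : m + d = n + 1) (hm2 : 2 < m)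
    {c cz : ℝ} (hc : 0 < c) (hcz : 0 ≤ cz) {S₁ U : Matrix (Fin d) (Fin d) ℝ}
    (hS₁ : S₁.PosSemidef) (hU : U.transpose * U = 1) {ν : Fin d → ℝ} (hν : ∀ j, 0 ≤ ν j)
    (hS₁U : S₁ = U * Matrix.diagonal ν * U.transpose) {δ : ℝ} (hδ : 0 < δ) :
    trainingLaw n (scalarCov d c) S₁ {ω | ∃ W, IsLeastSquaresDenoiser ω W ∧
      δ ≤ |genError (scalarCov d c) (scalarCov d cz) W - averagedError c cz (d / m)
        ((∑ i, shrinkage (c / d) ν i) / d) ((∑ i, shrinkage (c / d) ν i ^ 2) / d)|} ≤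
      ENNReal.ofReal (d / m * (2 / (m - 2) + √(80 / m)) / (δ / (2 * (c + cz)))) +
      ENNReal.ofReal ((160 * (c + cz) ^ 2 * d * (d / m + δ / (2 * (c + cz))) ^ 2 +
        8 * (c + cz) ^ 2 * (d / m + δ / (2 * (c + cz)))) / (d * (δ / 2)) ^ 2) := by
  have hd0 : (0 : ℝ) < d := by positivity
  have hm0 : (0 : ℝ) < m := by positivity
  have hs : 0 < c / d := by positivity
  set a := shrinkage (c / d) ν with ha
  have ha01 : ∀ i, a i ∈ Set.Icc (0 : ℝ) 1 := shrinkage_mem_Icc hs hν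
  set F := averagedError c cz (d / m) ((∑ i, a i) / d) ((∑ i, a i ^ 2) / d)
  have hF : F = (c + cz) * ((∑ i, a i ^ 2) / d + (∑ i, (1 - a i)) / d * ((∑ i, a i) / m)) -
      2 * c * ((∑ i, a i) / d) + c := by
    simp only [F, averagedError, Finset.sum_sub_distrib, Finset.sum_const, Finset.card_univ,
      Fintype.card_fin, nsmul_eq_mul, mul_one]
    field_simp
  have hU' : U * U.transpose = 1 := mul_eq_one_comm.1 hU
  set Φ := rotatedSample n U (fun _ => c / d) ν (fun j => √(a j)) (fun j => √(1 - a j)) with hΦ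
  set γ := Measure.pi fun _ : Fin d => stdGaussian (EuclideanSpace ℝ (Fin n)) with hγ
  set D := (c + cz) with hD
  have hD0 : 0 < D := by rw [hD]; linarith
  set τ := d / m + δ / (2 * D) with hτ
  have hτ0 : 0 ≤ τ := by positivity
  -- A measurable event containing the one of interest.
  set bad : Set ((Fin n → EuclideanSpace ℝ (Fin d)) × (Fin n → EuclideanSpace ℝ (Fin d))) :=
    {ω | ((dataMatrix ω.1 + dataMatrix ω.2).transpose *
        (dataMatrix ω.1 + dataMatrix ω.2)).det = 0} ∪
      {ω | δ ≤ |genError (scalarCov d c) (scalarCov d cz) (leastSquaresMatrix ω) - F|} with hbad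
  have hbadm : MeasurableSet bad := by
    have hY := continuous_noisy_dataMatrix (n := n) (d := d)
    refine MeasurableSet.union ?_ ?_
    · exact (isClosed_eq (hY.matrix_transpose.matrix_mul hY).matrix_det
        continuous_const).measurableSet
    · exact measurableSet_le measurable_const
        ((measurable_genError_leastSquaresMatrix hd hc.le hcz).sub_const F).abs
  have hsub : {ω | ∃ W, IsLeastSquaresDenoiser ω W ∧
      δ ≤ |genError (scalarCov d c) (scalarCov d cz) W - F|} ⊆ bad := by
    rintro ω ⟨W, hW, hdev⟩
    by_cases hdet : ((dataMatrix ω.1 + dataMatrix ω.2).transpose *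
        (dataMatrix ω.1 + dataMatrix ω.2)).det = 0
    · exact Or.inl hdet
    · have hWeq : W = leastSquaresMatrix ω := by
        rw [leastSquaresMatrix, ← hW.satisfiesNormalEquations, ← Matrix.mul_assoc,
          Matrix.nonsing_inv_mul _ (isUnit_iff_ne_zero.2 hdet), Matrix.one_mul]
      rw [hWeq] at hdev
      exact Or.inr hdev
  have hscal : scalarCov d c = U * Matrix.diagonal (fun _ => c / d) * U.transpose := by
    rw [scalarCov, ← Matrix.smul_one_eq_diagonal, Matrix.mul_smul, Matrix.mul_one,
      Matrix.smul_mul, hU']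
  have hΦm : Measurable Φ :=
    (LinearMap.continuous_of_finiteDimensional Φ).measurable
  have hlaw : (γ.prod γ).map Φ = trainingLaw n (scalarCov d c) S₁ := by
    have h1 := posSemidef_scalarCov d hc.le
    rw [hscal] at h1
    rw [hS₁U] at hS₁ ⊢
    rw [hscal]
    refine map_rotatedSample (fun _ => hs.le) hν (fun j => ?_) h1 hS₁
    rw [Real.sq_sqrt (ha01 j).1, Real.sq_sqrt (sub_nonneg.2 (ha01 j).2)]
    ring
  -- The two exceptional events.
  set B : Set (Fin d → EuclideanSpace ℝ (Fin n)) :=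
    {N | δ / (2 * D) ≤ |∑ i, a i * (Matrix.gram ℝ N)⁻¹ i i - (∑ i, a i) / m|} with hB
  have hBm : MeasurableSet B :=
    measurableSet_le measurable_const ((Finset.measurable_sum _ fun i _ =>
      (measurable_inv_gram i i).const_mul _).sub_const _).abs
  have hBle := measure_weighted_trace_inv_gram_le (E := EuclideanSpace ℝ (Fin n)) (m := m)
    (by simpa using hm) hm2 ha01 (δ := δ / (2 * D)) (by positivity)
  set t₂ := ENNReal.ofReal ((160 * D ^ 2 * d * τ ^ 2 + 8 * D ^ 2 * τ) / (d * (δ / 2)) ^ 2) with ht₂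
  have hsum1 : (∑ i, a i) / m ≤ d / m := by
    gcongr
    exact (Finset.sum_le_sum fun i _ => (ha01 i).2).trans_eq (by simp)
  have hsum2 : (∑ i, (1 - a i)) / d ≤ 1 := by
    rw [div_le_one hd0]
    exact (Finset.sum_le_sum fun i _ => sub_le_self 1 (ha01 i).1).trans_eq (by simp)
  have hsum2' : 0 ≤ (∑ i, (1 - a i)) / d :=
    div_nonneg (Finset.sum_nonneg fun i _ => sub_nonneg.2 (ha01 i).2) hd0.le
  have hsection (N : Fin d → EuclideanSpace ℝ (Fin n)) (hN : LinearIndependent ℝ N)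
      (hNB : N ∉ B) : γ (Prod.mk N ⁻¹' (Φ ⁻¹' bad)) ≤ t₂ := by
    set T := ∑ i, a i * ‖dualVector N i‖ ^ 2 with hT
    have hTK : T = ∑ i, a i * (Matrix.gram ℝ N)⁻¹ i i := by
      rw [hT]
      exact Finset.sum_congr rfl fun i _ => by rw [norm_dualVector_sq hN]
    have hT0 : 0 ≤ T := Finset.sum_nonneg fun i _ => mul_nonneg (ha01 i).1 (sq_nonneg _)
    have hTdev : |T - (∑ i, a i) / m| < δ / (2 * D) := by
      rw [hTK]; exact not_le.1 hNB
    have hTτ : T ≤ τ := by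
      have := (abs_lt.1 hTdev).2
      linarith
    have hβ (j : Fin d) : (√(a j) * √(1 - a j) * (2 * D * a j - 2 * c)) ^ 2 ≤
        4 * D ^ 2 * a j := by
      have h0 := (ha01 j).1
      have h1 := (ha01 j).2
      rw [mul_pow, mul_pow, Real.sq_sqrt h0, Real.sq_sqrt (sub_nonneg.2 h1)]
      have h2 : (2 * D * a j - 2 * c) ^ 2 ≤ 4 * D ^ 2 := by
        have e : 4 * D ^ 2 = (2 * D) ^ 2 := by ring
        rw [e]
        refine sq_le_sq' ?_ ?_ <;> nlinarith
      have h3 : a j * (1 - a j) * (2 * D * a j - 2 * c) ^ 2 ≤ a j * (1 - a j) * (4 * D ^ 2) :=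
        mul_le_mul_of_nonneg_left h2 (mul_nonneg h0 (sub_nonneg.2 h1))
      nlinarith [mul_nonneg h0 (mul_nonneg h0 (sq_nonneg D))]
    have hfl := measure_quadratic_form_fluctuation_le ha01 (dualVector N) D hβ
      (δ := d * (δ / 2)) (by positivity)
    rw [← hT] at hfl
    refine (measure_mono ?_).trans (hfl.trans (ENNReal.ofReal_le_ofReal ?_))
    · intro g hg
      have hdet : ((dataMatrix (Φ (N, g)).1 + dataMatrix (Φ (N, g)).2).transpose *
          (dataMatrix (Φ (N, g)).1 + dataMatrix (Φ (N, g)).2)).det ≠ 0 :=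
        det_noisy_gram_ne_zero hU hs hν (p := (N, g)) hN rfl
      have hne : SatisfiesNormalEquations (Φ (N, g)) (leastSquaresMatrix (Φ (N, g))) := by
        rw [SatisfiesNormalEquations, leastSquaresMatrix, ← Matrix.mul_assoc,
          Matrix.mul_nonsing_inv _ (isUnit_iff_ne_zero.2 hdet), Matrix.one_mul]
      have hdev : δ ≤ |genError (scalarCov d c) (scalarCov d cz)
          (leastSquaresMatrix (Φ (N, g))) - F| := hg.resolve_left hdet
      have hgen := hne.genError_eq hd hc hcz hU hs hν (p := (N, g)) hN
      rw [← ha, ← hD] at hgen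
      rw [hgen] at hdev
      set Ψ := ∑ j, (D * (1 - a j) * ∑ i, a i * (inner ℝ (dualVector N i) (g j)) ^ 2 +
          √(a j) * √(1 - a j) * (2 * D * a j - 2 * c) * inner ℝ (dualVector N j) (g j)) with hΨ
      change d * (δ / 2) ≤ |Ψ - D * (∑ j, (1 - a j)) * T|
      have hsplit : D * ((∑ i, a i ^ 2) / d) - 2 * c * ((∑ i, a i) / d) + c + Ψ / d - F =
          (Ψ - D * (∑ j, (1 - a j)) * T) / d +
            D * ((∑ i, (1 - a i)) / d * (T - (∑ i, a i) / m)) := by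
        rw [hF]; field_simp; ring
      rw [hsplit] at hdev
      have h1 := hdev.trans (abs_add_le _ _)
      have h2 : |D * ((∑ i, (1 - a i)) / d * (T - (∑ i, a i) / m))| ≤ δ / 2 := by
        rw [abs_mul, abs_mul, abs_of_pos hD0, abs_of_nonneg hsum2']
        calc _ ≤ D * (1 * (δ / (2 * D))) := by gcongr
          _ = δ / 2 := by field_simp
      rw [abs_div, abs_of_pos hd0] at h1
      have h3 : δ / 2 ≤ |Ψ - D * (∑ j, (1 - a j)) * T| / d := by linarith
      rwa [le_div_iff₀ hd0, mul_comm] at h3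
    · rw [show 2 * (4 * D ^ 2) = 8 * D ^ 2 by ring]
      gcongr
  calc trainingLaw n (scalarCov d c) S₁ _
      ≤ trainingLaw n (scalarCov d c) S₁ bad := measure_mono hsub
    _ = ∫⁻ N, γ (Prod.mk N ⁻¹' (Φ ⁻¹' bad)) ∂γ := by
        rw [← hlaw, Measure.map_apply hΦm hbadm, Measure.prod_apply (hΦm hbadm)]
    _ ≤ ∫⁻ N, (B.indicator 1 N + t₂) ∂γ := by
        refine lintegral_mono_ae ?_
        filter_upwards [ae_linearIndependent (E := EuclideanSpace ℝ (Fin n)) (d := d)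
          (by rw [finrank_euclideanSpace_fin]; omega)] with N hN
        by_cases hNB : N ∈ B
        · rw [Set.indicator_of_mem hNB]
          exact prob_le_one.trans le_self_add
        · exact (hsection N hN hNB).trans le_add_self
    _ = γ B + t₂ := by
        rw [lintegral_add_right _ measurable_const, lintegral_indicator_one hBm]
        simp
    _ ≤ _ := by gcongr

end Concentration

/-! ### The optimal shrinkage factor -/

section Optimization

variable {c cz κ : ℝ}

lemma two_lt_of_interior (hc : 0 < c) (hcz : 0 ≤ cz)
    (h : (3 - 2 * κ) * c + cz < 0 ∧ c + (3 - 2 * κ) * cz < 0) : 2 < κ := by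
  by_contra hκ
  nlinarith [h.1, h.2]

/-- Completing the square in the averaged error with equal shrinkage factors. -/
lemma averagedError_eq (hc : 0 < c) (hcz : 0 ≤ cz) (hκ : 2 < κ) (s : ℝ) :
    averagedError c cz (1 / (κ - 1)) s (s ^ 2) =
      (-(c + cz) ^ 2 + 4 * (κ - 1) ^ 2 * c * cz) / (4 * (κ - 2) * (κ - 1) * (c + cz)) +
      (c + cz) * (κ - 2) / (κ - 1) *
        (s - (2 * c * (κ - 1) - (c + cz)) / (2 * (c + cz) * (κ - 2))) ^ 2 := by
  have h1 : κ - 1 ≠ 0 := by linarith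
  have h2 : κ - 2 ≠ 0 := by linarith
  have h3 : c + cz ≠ 0 := by linarith
  unfold averagedError
  field_simp
  ring

lemma averagedError_mono {r s q q' : ℝ} (hc : 0 < c) (hcz : 0 ≤ cz) (h : q ≤ q') :
    averagedError c cz r s q ≤ averagedError c cz r s q' := by
  unfold averagedError
  gcongr

lemma abs_averagedError_sub_le {r r' s q : ℝ} (hc : 0 < c) (hcz : 0 ≤ cz) (hs : s ∈ Set.Icc 0 1) :
    |averagedError c cz r s q - averagedError c cz r' s q| ≤ (c + cz) * |r - r'| := by
  have h : averagedError c cz r s q - averagedError c cz r' s q =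
      (c + cz) * (((1 - s) * s) * (r - r')) := by unfold averagedError; ring
  have h0 := hs.1
  have h1 := hs.2
  rw [h, abs_mul, abs_mul, abs_of_pos (show 0 < c + cz by linarith),
    abs_of_nonneg (mul_nonneg (sub_nonneg.2 h1) h0)]
  have h2 : (1 - s) * s ≤ 1 := by nlinarith
  have := mul_le_of_le_one_left (abs_nonneg (r - r')) h2
  gcongr

/-- Minimization over `s ∈ [0, 1]`. The end points `0` and `1` give the errors `c` and `cz`. -/
lemma optimalError_le_averagedError_sq (hc : 0 < c) (hcz : 0 ≤ cz) (hκ : 1 < κ) {s : ℝ}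
    (hs : s ∈ Set.Icc 0 1) :
    optimalError c cz κ ≤ averagedError c cz (1 / (κ - 1)) s (s ^ 2) := by
  have h0 := hs.1
  have h1 : 0 ≤ 1 - s := sub_nonneg.2 hs.2
  have hκ1 : 0 < κ - 1 := by linarith
  have hD : 0 < c + cz := by linarith
  unfold optimalError
  split_ifs with h
  · have hκ2 : 0 < κ - 2 := by linarith [two_lt_of_interior hc hcz h]
    rw [averagedError_eq hc hcz (by linarith)]
    exact le_add_of_nonneg_right (by positivity)
  · have hchord : averagedError c cz (1 / (κ - 1)) s (s ^ 2) =
        ((1 - s) * c + s * cz) + (c + cz) * (s * (1 - s)) * ((2 - κ) / (κ - 1)) := by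
      unfold averagedError; field_simp; ring
    rcases le_or_gt κ 2 with hκ2 | hκ2
    · -- For `κ ≤ 2` the averaged error is concave in `s`, hence minimal at an end point.
      rw [hchord]
      have h2 : 0 ≤ (c + cz) * (s * (1 - s)) * ((2 - κ) / (κ - 1)) := by
        have := div_nonneg (sub_nonneg.2 hκ2) hκ1.le
        positivity
      have h3 : min c cz ≤ (1 - s) * c + s * cz := by
        have e1 := mul_le_mul_of_nonneg_left (min_le_left c cz) h1
        have e2 := mul_le_mul_of_nonneg_left (min_le_right c cz) h0
        linarith
      linarith
    · rw [not_and_or, not_lt, not_lt] at h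
      have hκ2' : 0 < κ - 2 := by linarith
      rcases h with h | h
      · refine (min_le_left _ _).trans ?_
        have e : averagedError c cz (1 / (κ - 1)) s (s ^ 2) = c +
            s * (((3 - 2 * κ) * c + cz) / (κ - 1) + s * ((c + cz) * (κ - 2) / (κ - 1))) := by
          unfold averagedError; field_simp; ring
        rw [e]
        exact le_add_of_nonneg_right (by positivity)
      · refine (min_le_right _ _).trans ?_
        have e : averagedError c cz (1 / (κ - 1)) s (s ^ 2) = cz +
            (1 - s) * ((c + (3 - 2 * κ) * cz) / (κ - 1) +
              (1 - s) * ((c + cz) * (κ - 2) / (κ - 1))) := by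
          unfold averagedError; field_simp; ring
        rw [e]
        exact le_add_of_nonneg_right (by positivity)

lemma exists_averagedError_eq_optimalError (hc : 0 < c) (hcz : 0 ≤ cz) (κ : ℝ) :
    ∃ s ∈ Set.Icc (0 : ℝ) 1,
      averagedError c cz (1 / (κ - 1)) s (s ^ 2) = optimalError c cz κ := by
  have hD : 0 < c + cz := by linarith
  unfold optimalError
  split_ifs with h
  · have hκ2 := two_lt_of_interior hc hcz h
    have hκ2' : 0 < κ - 2 := by linarith
    refine ⟨(2 * c * (κ - 1) - (c + cz)) / (2 * (c + cz) * (κ - 2)), ⟨?_, ?_⟩, ?_⟩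
    · exact div_nonneg (by nlinarith [h.1]) (by positivity)
    · rw [div_le_one (by positivity)]
      nlinarith [h.2]
    · rw [averagedError_eq hc hcz hκ2]
      simp
  · rcases le_total c cz with hle | hle
    · exact ⟨0, by simp, by simp [averagedError, hle]⟩
    · exact ⟨1, by simp, by rw [min_eq_right hle]; unfold averagedError; ring⟩

lemma optimalError_lt_min_iff (hc : 0 < c) (hcz : 0 ≤ cz) :
    optimalError c cz κ < min c cz ↔
      (3 - 2 * κ) * c + cz < 0 ∧ c + (3 - 2 * κ) * cz < 0 := by
  constructor
  · intro hlt
    by_contra h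
    rw [optimalError, if_neg h] at hlt
    exact lt_irrefl _ hlt
  · intro h
    have hκ2 := two_lt_of_interior hc hcz h
    have hκ2' : 0 < κ - 2 := by linarith
    have hκ1 : 0 < κ - 1 := by linarith
    have hD : 0 < c + cz := by linarith
    rw [optimalError, if_pos h]
    have e1 : (-(c + cz) ^ 2 + 4 * (κ - 1) ^ 2 * c * cz) / (4 * (κ - 2) * (κ - 1) * (c + cz)) =
        c - ((3 - 2 * κ) * c + cz) ^ 2 / (4 * (κ - 2) * (κ - 1) * (c + cz)) := by
      field_simp; ring
    have e2 : (-(c + cz) ^ 2 + 4 * (κ - 1) ^ 2 * c * cz) / (4 * (κ - 2) * (κ - 1) * (c + cz)) =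
        cz - (c + (3 - 2 * κ) * cz) ^ 2 / (4 * (κ - 2) * (κ - 1) * (c + cz)) := by
      field_simp; ring
    refine lt_min ?_ ?_
    · rw [e1]
      have := sq_pos_of_neg h.1
      exact sub_lt_self _ (by positivity)
    · rw [e2]
      have := sq_pos_of_neg h.2
      exact sub_lt_self _ (by positivity)

end Optimization

/-! ### Passage to the limit -/

section Asymptotics

open scoped ENNReal

lemma exists_orthogonal_diagonalization {d : ℕ} {S : Matrix (Fin d) (Fin d) ℝ}
    (hS : S.PosSemidef) :
    ∃ (U : Matrix (Fin d) (Fin d) ℝ) (ν : Fin d → ℝ), U.transpose * U = 1 ∧ (∀ j, 0 ≤ ν j) ∧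
      S = U * Matrix.diagonal ν * U.transpose := by
  refine ⟨hS.isHermitian.eigenvectorUnitary, hS.isHermitian.eigenvalues, ?_, hS.eigenvalues_nonneg,
    ?_⟩
  · have := Unitary.coe_star_mul_self hS.isHermitian.eigenvectorUnitary
    simpa [Matrix.star_eq_conjTranspose] using this
  · have := hS.isHermitian.spectral_theorem
    simpa [Unitary.conjStarAlgAut_apply, Matrix.star_eq_conjTranspose, Function.comp_def] using this

variable {c cz κ : ℝ} {n d : ℕ → ℕ}

lemma tendsto_excess_ratio (hd : Tendsto d atTop atTop)
    (hnd : Tendsto (fun k => (n k : ℝ) / (d k : ℝ)) atTop (𝓝 κ)) :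
    Tendsto (fun k => ((n k : ℝ) + 1 - d k) / d k) atTop (𝓝 (κ - 1)) := by
  have hdR : Tendsto (fun k => (d k : ℝ)) atTop atTop := tendsto_natCast_atTop_atTop.comp hd
  have h := (hnd.add (tendsto_inv_atTop_zero.comp hdR)).sub_const 1
  rw [add_zero] at h
  refine h.congr' ?_
  filter_upwards [hd.eventually_gt_atTop 0] with k hk
  have : (d k : ℝ) ≠ 0 := by positivity
  simp only [Function.comp_apply]
  field_simp

lemma tendsto_excess (hκ : 1 < κ) (hd : Tendsto d atTop atTop)
    (hnd : Tendsto (fun k => (n k : ℝ) / (d k : ℝ)) atTop (𝓝 κ)) :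
    Tendsto (fun k => (n k : ℝ) + 1 - d k) atTop atTop := by
  have hdR : Tendsto (fun k => (d k : ℝ)) atTop atTop := tendsto_natCast_atTop_atTop.comp hd
  refine ((tendsto_excess_ratio hd hnd).pos_mul_atTop (by linarith) hdR).congr' ?_
  filter_upwards [hd.eventually_gt_atTop 0] with k hk
  have : (d k : ℝ) ≠ 0 := by positivity
  field_simp

/-- The generalization error concentrates in probability, for arbitrary training noise. -/
lemma tendsto_measure_genError_deviation (hc : 0 < c) (hcz : 0 ≤ cz) (hκ : 1 < κ)
    (hd : Tendsto d atTop atTop)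
    (hnd : Tendsto (fun k => (n k : ℝ) / (d k : ℝ)) atTop (𝓝 κ))
    {S₁ U : (k : ℕ) → Matrix (Fin (d k)) (Fin (d k)) ℝ} {ν : (k : ℕ) → Fin (d k) → ℝ}
    (hS₁ : ∀ k, (S₁ k).PosSemidef) (hU : ∀ k, (U k).transpose * U k = 1)
    (hν : ∀ k j, 0 ≤ ν k j) (hS₁U : ∀ k, S₁ k = U k * Matrix.diagonal (ν k) * (U k).transpose)
    {δ : ℝ} (hδ : 0 < δ) :
    Tendsto (fun k => trainingLaw (n k) (scalarCov (d k) c) (S₁ k)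
      {ω | ∃ W, IsLeastSquaresDenoiser ω W ∧
        δ ≤ |genError (scalarCov (d k) c) (scalarCov (d k) cz) W -
          averagedError c cz (d k / (n k + 1 - d k))
            ((∑ i, shrinkage (c / d k) (ν k) i) / d k)
            ((∑ i, shrinkage (c / d k) (ν k) i ^ 2) / d k)|}) atTop (𝓝 0) := by
  set m : ℕ → ℝ := fun k => (n k : ℝ) + 1 - d k with hm
  have hD : 0 < c + cz := by linarith
  have hκ1 : 0 < κ - 1 := by linarith
  have hdR : Tendsto (fun k => (d k : ℝ)) atTop atTop := tendsto_natCast_atTop_atTop.comp hd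
  have hmR : Tendsto m atTop atTop := tendsto_excess hκ hd hnd
  have hr : Tendsto (fun k => (d k : ℝ) / m k) atTop (𝓝 (κ - 1)⁻¹) := by
    refine ((tendsto_excess_ratio hd hnd).inv₀ hκ1.ne').congr fun k => ?_
    rw [inv_div]
  set δ' := δ / (2 * (c + cz)) with hδ'
  have hbound1 : Tendsto (fun k => (d k : ℝ) / m k * (2 / (m k - 2) + √(80 / m k)) / δ')
      atTop (𝓝 0) := by
    have h1 : Tendsto (fun k => 2 / (m k - 2)) atTop (𝓝 0) :=
      (tendsto_atTop_add_const_right _ (-2) hmR).const_div_atTop 2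
    have h2 : Tendsto (fun k => √(80 / m k)) atTop (𝓝 0) := by
      have := (Real.continuous_sqrt.tendsto 0).comp (hmR.const_div_atTop 80)
      simpa only [Real.sqrt_zero, Function.comp_def] using this
    have := (hr.mul (h1.add h2)).div_const δ'
    simpa using this
  have hbound2 : Tendsto (fun k => (160 * (c + cz) ^ 2 * d k * (d k / m k + δ') ^ 2 +
      8 * (c + cz) ^ 2 * (d k / m k + δ')) / (d k * (δ / 2)) ^ 2) atTop (𝓝 0) := by
    have hi : Tendsto (fun k => (d k : ℝ)⁻¹) atTop (𝓝 0) := tendsto_inv_atTop_zero.comp hdR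
    have hτ := hr.add_const δ'
    have h := (((hi.mul (hτ.pow 2)).const_mul (160 * (c + cz) ^ 2)).add
      (((hi.pow 2).mul hτ).const_mul (8 * (c + cz) ^ 2))).div_const ((δ / 2) ^ 2)
    simp only [zero_mul, mul_zero, ne_eq, OfNat.ofNat_ne_zero, not_false_eq_true, zero_pow,
      add_zero, zero_div] at h
    refine h.congr' ?_
    filter_upwards [hd.eventually_gt_atTop 0] with k hk
    have : (d k : ℝ) ≠ 0 := by positivity
    field_simp
  have hbound := (ENNReal.tendsto_ofReal hbound1).add (ENNReal.tendsto_ofReal hbound2)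
  simp only [ENNReal.ofReal_zero, add_zero] at hbound
  refine tendsto_of_tendsto_of_tendsto_of_le_of_le' tendsto_const_nhds hbound
    (Eventually.of_forall fun k => bot_le) ?_
  filter_upwards [hd.eventually_gt_atTop 0, hmR.eventually_gt_atTop 2] with k hk hmk
  have hle : d k ≤ n k + 1 := by
    have h : (d k : ℝ) < (n k : ℝ) + 1 := by simp only [hm] at hmk; linarith
    exact_mod_cast h.le
  have hcast : ((n k + 1 - d k : ℕ) : ℝ) = m k := by
    rw [Nat.cast_sub hle]; simp [hm]
  have h := measure_genError_deviation_le (n := n k) hk (m := n k + 1 - d k) (by omega)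
    (by have : (2 : ℝ) < ((n k + 1 - d k : ℕ) : ℝ) := by rw [hcast]; exact hmk
        exact_mod_cast this) hc hcz (hS₁ k) (hU k) (hν k) (hS₁U k) hδ
  rw [hcast] at h
  exact h

lemma mean_shrinkage_mem_Icc {d : ℕ} (hd : 0 < d) {s : ℝ} (hs : 0 < s) {ν : Fin d → ℝ}
    (hν : ∀ j, 0 ≤ ν j) : (∑ i, shrinkage s ν i) / d ∈ Set.Icc (0 : ℝ) 1 := by
  have h := shrinkage_mem_Icc hs hν
  refine ⟨div_nonneg (Finset.sum_nonneg fun i _ => (h i).1) (by positivity), ?_⟩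
  rw [div_le_one (by positivity)]
  exact (Finset.sum_le_sum fun i _ => (h i).2).trans_eq (by simp)

lemma sq_mean_le_mean_sq {d : ℕ} (a : Fin d → ℝ) : ((∑ i, a i) / d) ^ 2 ≤ (∑ i, a i ^ 2) / d := by
  rcases Nat.eq_zero_or_pos d with rfl | hd
  · simp
  · have h := sq_sum_le_card_mul_sum_sq (s := Finset.univ) (f := a)
    rw [Finset.card_univ, Fintype.card_fin] at h
    rw [div_pow, div_le_div_iff₀ (by positivity) (by positivity)]
    nlinarith [mul_le_mul_of_nonneg_left h (show (0 : ℝ) ≤ d by positivity)]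

/-- At finite size the concentration value is eventually close to its limiting form, uniformly in
the shrinkage factors. -/
lemma eventually_averagedError_close (hc : 0 < c) (hcz : 0 ≤ cz) (hκ : 1 < κ)
    (hd : Tendsto d atTop atTop)
    (hnd : Tendsto (fun k => (n k : ℝ) / (d k : ℝ)) atTop (𝓝 κ)) {ε : ℝ} (hε : 0 < ε) :
    ∀ᶠ k in atTop, ∀ s ∈ Set.Icc (0 : ℝ) 1, ∀ q,
      |averagedError c cz (d k / (n k + 1 - d k)) s q - averagedError c cz (1 / (κ - 1)) s q| <
        ε := by
  have hD : 0 < c + cz := by linarith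
  have hr : Tendsto (fun k => (d k : ℝ) / ((n k : ℝ) + 1 - d k)) atTop (𝓝 (1 / (κ - 1))) := by
    rw [one_div]
    refine ((tendsto_excess_ratio hd hnd).inv₀ (by linarith)).congr fun k => ?_
    rw [inv_div]
  filter_upwards [Metric.tendsto_nhds.1 hr (ε / (c + cz)) (by positivity)] with k hk s hs q
  rw [Real.dist_eq, lt_div_iff₀ hD, mul_comm] at hk
  exact (abs_averagedError_sub_le hc hcz hs).trans_lt hk

/-- No training noise beats the optimal error: the concentration value is monotone in the mean
square of the shrinkage factors, which is at least the square of their mean. -/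
lemma tendsto_measure_genError_le (hc : 0 < c) (hcz : 0 ≤ cz) (hκ : 1 < κ)
    (hd : Tendsto d atTop atTop)
    (hnd : Tendsto (fun k => (n k : ℝ) / (d k : ℝ)) atTop (𝓝 κ))
    (S₁ : (k : ℕ) → Matrix (Fin (d k)) (Fin (d k)) ℝ) (hS₁ : ∀ k, (S₁ k).PosSemidef)
    {ε : ℝ} (hε : 0 < ε) :
    Tendsto (fun k => trainingLaw (n k) (scalarCov (d k) c) (S₁ k)
      {ω | ∃ W, IsLeastSquaresDenoiser ω W ∧
        genError (scalarCov (d k) c) (scalarCov (d k) cz) W ≤ optimalError c cz κ - ε})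
      atTop (𝓝 0) := by
  choose U ν hU hν hS₁U using fun k => exists_orthogonal_diagonalization (hS₁ k)
  refine tendsto_of_tendsto_of_tendsto_of_le_of_le' tendsto_const_nhds
    (tendsto_measure_genError_deviation hc hcz hκ hd hnd hS₁ hU hν hS₁U (half_pos hε))
    (Eventually.of_forall fun k => bot_le) ?_
  filter_upwards [hd.eventually_gt_atTop 0,
    eventually_averagedError_close hc hcz hκ hd hnd (half_pos hε)] with k hk hclose
  refine measure_mono ?_
  rintro ω ⟨W, hW, hle⟩
  refine ⟨W, hW, ?_⟩
  have hs : 0 < c / d k := by positivity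
  have hmean := mean_shrinkage_mem_Icc hk hs (hν k)
  have h1 := abs_lt.1 (hclose _ hmean ((∑ i, shrinkage (c / d k) (ν k) i ^ 2) / d k))
  have h2 := optimalError_le_averagedError_sq hc hcz hκ hmean
  have h3 := averagedError_mono (r := 1 / (κ - 1)) (s := (∑ i, shrinkage (c / d k) (ν k) i) / d k)
    hc hcz (sq_mean_le_mean_sq (shrinkage (c / d k) (ν k)))
  rw [abs_sub_comm]
  refine le_trans ?_ (le_abs_self _)
  linarith [h1.1]

/-- The optimal error is attained by scalar noise, for which all shrinkage factors agree. -/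
lemma exists_tendsto_measure_genError (hc : 0 < c) (hcz : 0 ≤ cz) (hκ : 1 < κ)
    (hd : Tendsto d atTop atTop)
    (hnd : Tendsto (fun k => (n k : ℝ) / (d k : ℝ)) atTop (𝓝 κ)) :
    ∃ S₁ : (k : ℕ) → Matrix (Fin (d k)) (Fin (d k)) ℝ, (∀ k, (S₁ k).PosSemidef) ∧
      ∀ ε : ℝ, 0 < ε → Tendsto (fun k => trainingLaw (n k) (scalarCov (d k) c) (S₁ k)
        {ω | ∃ W, IsLeastSquaresDenoiser ω W ∧
          ε ≤ |genError (scalarCov (d k) c) (scalarCov (d k) cz) W - optimalError c cz κ|})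
        atTop (𝓝 0) := by
  obtain ⟨s, hs, hopt⟩ := exists_averagedError_eq_optimalError hc hcz κ
  have hdR : Tendsto (fun k => (d k : ℝ)) atTop atTop := tendsto_natCast_atTop_atTop.comp hd
  -- The optimal factor may be `0`, which is attained only in the limit.
  set σ : ℕ → ℝ := fun k => max s (1 / (1 + d k)) with hσ
  have hσpos (k : ℕ) : 0 < σ k := lt_max_of_lt_right (by positivity)
  have hσle (k : ℕ) : σ k ≤ 1 := by
    refine max_le hs.2 ?_
    rw [div_le_one (by positivity)]
    exact le_add_of_nonneg_right (by positivity)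
  have hσlim : Tendsto σ atTop (𝓝 s) := by
    have h := (tendsto_const_nhds (x := s)).max
      ((tendsto_atTop_add_const_left _ (1 : ℝ) hdR).const_div_atTop 1)
    rwa [max_eq_left hs.1] at h
  set t : ℕ → ℝ := fun k => c / d k * ((σ k)⁻¹ - 1) with ht
  have ht0 (k : ℕ) : 0 ≤ t k :=
    mul_nonneg (by positivity) (sub_nonneg.2 ((one_le_inv₀ (hσpos k)).2 (hσle k)))
  set S₁ : (k : ℕ) → Matrix (Fin (d k)) (Fin (d k)) ℝ := fun k => t k • 1 with hS₁
  have hpsd (k : ℕ) : (S₁ k).PosSemidef := Matrix.PosSemidef.one.smul (ht0 k)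
  refine ⟨S₁, hpsd, fun ε hε => ?_⟩
  have hdev := tendsto_measure_genError_deviation hc hcz hκ hd hnd hpsd (U := fun k => 1)
    (ν := fun k _ => t k) (fun k => by simp) (fun k _ => ht0 k)
    (fun k => by simp [hS₁, Matrix.smul_one_eq_diagonal]) (half_pos hε)
  refine tendsto_of_tendsto_of_tendsto_of_le_of_le' tendsto_const_nhds hdev
    (Eventually.of_forall fun k => bot_le) ?_
  have hlim : Tendsto (fun k => averagedError c cz (1 / (κ - 1)) (σ k) (σ k ^ 2)) atTop
      (𝓝 (optimalError c cz κ)) := by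
    rw [← hopt]
    have hcont : Continuous fun x : ℝ => averagedError c cz (1 / (κ - 1)) x (x ^ 2) := by
      unfold averagedError; fun_prop
    exact (hcont.tendsto s).comp hσlim
  filter_upwards [hd.eventually_gt_atTop 0,
    eventually_averagedError_close hc hcz hκ hd hnd (ε := ε / 4) (by positivity),
    Metric.tendsto_nhds.1 hlim (ε / 4) (by positivity)] with k hk hclose hlimk
  refine measure_mono ?_
  rintro ω ⟨W, hW, hle⟩
  refine ⟨W, hW, ?_⟩
  have hdk : (0 : ℝ) < d k := by positivity
  have hshr (i : Fin (d k)) : shrinkage (c / d k) (fun _ => t k) i = σ k := by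
    have := (hσpos k).ne'
    simp only [shrinkage, ht]
    field_simp
    ring
  simp only [hshr, Finset.sum_const, Finset.card_univ, Fintype.card_fin, nsmul_eq_mul]
  rw [mul_div_cancel_left₀ _ hdk.ne', mul_div_cancel_left₀ _ hdk.ne']
  have h1 := hclose (σ k) ⟨(hσpos k).le, hσle k⟩ (σ k ^ 2)
  rw [Real.dist_eq] at hlimk
  set g := genError (scalarCov (d k) c) (scalarCov (d k) cz) W
  set f := averagedError c cz (d k / (n k + 1 - d k)) (σ k) (σ k ^ 2)
  have h2 := abs_sub_le g f (optimalError c cz κ)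
  have h3 := abs_sub_le f (averagedError c cz (1 / (κ - 1)) (σ k) (σ k ^ 2)) (optimalError c cz κ)
  linarith

end Asymptotics
end LinearDenoiser

theorem corollary2 (c cz κ : ℝ) (hc : 0 < c) (hcz : 0 ≤ cz) (hκ : 1 < κ)
    (n d : ℕ → ℕ) (hd : Tendsto d atTop atTop)
    (hnd : Tendsto (fun k => (n k : ℝ) / (d k : ℝ)) atTop (𝓝 κ)) :
    -- no choice of training noise does asymptotically better than the stated value
    (∀ S₁ : (k : ℕ) → Matrix (Fin (d k)) (Fin (d k)) ℝ, (∀ k, (S₁ k).PosSemidef) →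
      ∀ ε : ℝ, 0 < ε →
        Tendsto (fun k => LinearDenoiser.trainingLaw (n k)
            (LinearDenoiser.scalarCov (d k) c) (S₁ k)
            {ω | ∃ W, LinearDenoiser.IsLeastSquaresDenoiser ω W ∧
              LinearDenoiser.genError (LinearDenoiser.scalarCov (d k) c)
                (LinearDenoiser.scalarCov (d k) cz) W ≤
                  LinearDenoiser.optimalError c cz κ - ε})
          atTop (𝓝 0)) ∧
    -- some choice of training noise attains the stated value asymptotically
    (∃ S₁ : (k : ℕ) → Matrix (Fin (d k)) (Fin (d k)) ℝ, (∀ k, (S₁ k).PosSemidef) ∧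
      ∀ ε : ℝ, 0 < ε →
        Tendsto (fun k => LinearDenoiser.trainingLaw (n k)
            (LinearDenoiser.scalarCov (d k) c) (S₁ k)
            {ω | ∃ W, LinearDenoiser.IsLeastSquaresDenoiser ω W ∧
              ε ≤ |LinearDenoiser.genError (LinearDenoiser.scalarCov (d k) c)
                (LinearDenoiser.scalarCov (d k) cz) W -
                  LinearDenoiser.optimalError c cz κ|})
          atTop (𝓝 0)) ∧
    -- the phase transition: the value drops below `min c cz` exactly in the first regime
    (LinearDenoiser.optimalError c cz κ < min c cz ↔
      (3 - 2 * κ) * c + cz < 0 ∧ c + (3 - 2 * κ) * cz < 0) := by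
  exact ⟨fun S₁ hS₁ ε hε =>
      LinearDenoiser.tendsto_measure_genError_le hc hcz hκ hd hnd S₁ hS₁ hε,
    LinearDenoiser.exists_tendsto_measure_genError hc hcz hκ hd hnd,
    LinearDenoiser.optimalError_lt_min_iff hc hcz⟩
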